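/- Let $(\Sigma,g)$ be a compact connected smooth Riemannian surface without boundary (orientable or not) with total area $\int_\Sigma 1\,dV_g=1$, and let $d$ be its Riemannian distance. Let $h_1,h_2:\Sigma\to(0,\infty)$ be $C^1$ functions and let $\rho=(\rho_1,\rho_2)$ with $\rho_1,\rho_2>4\pi$. For $u_1,u_2\in H^1(\Sigma)$ put $$J_\rho(u_1,u_2)=\int_\Sigma \tfrac13\left(|\nabla u_1|^2+|\nabla u_2|^2+\nabla u_1\cdot\nabla u_2\right)dV_g+\sum_{i=1}^2\rho_i\left(\int_\Sigma u_i\,dV_g-\log\int_\Sigma h_ie^{u_i}\,dV_g\right).$$ Fix $\delta>0$. Let $\overline\Sigma_\delta$ be the cone obtained from $\Sigma\times(0,\infty)$ by collapsing $\Sigma\times[\delta,\infty)$ to one point, and let $X=(\overline\Sigma_\delta\times\overline\Sigma_\delta)\setminus\{(\vartheta,\vartheta)\}$ be the complement of the diagonal. For $\nu>0$ let $\mathcal X_\nu=\mathcal X_{\nu,1}\cup\mathcal X_{\nu,2}\subseteq X$, where $$\mathcal X_{\nu,1}=\left\{((x_1,t_1),(x_2,t_2))\in X:\ |t_1-t_2|^2+d(x_1,x_2)^2\ge\delta^4,\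 \max\{t_1,t_2\}<\delta,\ \min\{t_1,t_2\}\in[\nu^2,\nu]\right\},$$ $$\mathcal X_{\nu,2}=\left\{((x_1,t_1),(x_2,t_2))\in X:\ \max\{t_1,t_2\}=\delta,\ \min\{t_1,t_2\}\in[\nu^2,\nu]\right\}.$$ For $(\vartheta_1,\vartheta_2)=((x_1,t_1),(x_2,t_2))\in\mathcal X_\nu$ (with $t_1,t_2\le\delta$) let $\varphi_{(\vartheta_1,\vartheta_2)}=(\varphi_1,\varphi_2)$ with $$\varphi_1(y)=\log\frac{1+\tilde t_2^2\,d(x_2,y)^2}{\left(1+\tilde t_1^2\,d(x_1,y)^2\right)^2},\qquad \varphi_2(y)=\log\frac{1+\tilde t_1^2\,d(x_1,y)^2}{\left(1+\tilde t_2^2\,d(x_2,y)^2\right)^2},$$ where $\tilde t_i=1/t_i$ if $t_i\le\delta/2$ and $\tilde t_i=-\frac4{\delta^2}(t_i-\delta)$ if $t_i\ge\delta/2$; this does not depend on the representatives since $\tilde t_i=0$ for $t_i=\delta$. Then $\varphi_1,\varphi_2\in H^1(\Sigma)$ for all $\nu>0$ and $(\vartheta_1,\vartheta_2)\in\mathcal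 X_\nu$, and $$J_\rho(\varphi_{(\vartheta_1,\vartheta_2)})\to-\infty\quad\text{as }\nu\to0,\ \text{uniformly for }(\vartheta_1,\vartheta_2)\in\mathcal X_\nu,$$ that is, for every $L\in\mathbb R$ there is $\nu_0>0$ such that $J_\rho(\varphi_{(\vartheta_1,\vartheta_2)})\le -L$ for all $0<\nu<\nu_0$ and all $(\vartheta_1,\vartheta_2)\in\mathcal X_\nu$. -/

import Mathlib

open MeasureTheory Set Filter Topology Manifold Bundle
open scoped ContDiff

noncomputable section

namespace Toda

/-- The coordinate plane `ℝ²`, with its Euclidean norm and Lebesgue measure. -/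
abbrev Plane : Type := EuclideanSpace ℝ (Fin 2)

/-! ### Riemannian volume, weak gradients and `H¹` on a surface -/

section Surface

variable {M : Type*} [MetricSpace M] [ChartedSpace Plane M]

/-- For a chart `e`, a point `z` of its target and `v ∈ ℝ²`: the coordinate vector
`v¹ ∂₁ + v² ∂₂` at the point `e⁻¹ z` of the surface. -/
def coordVec (e : OpenPartialHomeomorph M Plane) (z v : Plane) : TangentSpace (𝓡 2) (e.symm z) :=
  mfderiv 𝓘(ℝ, Plane) (𝓡 2) e.symm z v

variable [RiemannianBundle (fun x : M ↦ TangentSpace (𝓡 2) x)]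

/-- The matrix `(g_{ij})` of the metric in the coordinates of the chart `e`. -/
def gram (e : OpenPartialHomeomorph M Plane) (z : Plane) : Matrix (Fin 2) (Fin 2) ℝ :=
  Matrix.of fun i j ↦ inner ℝ (coordVec e z (EuclideanSpace.single i 1))
    (coordVec e z (EuclideanSpace.single j 1))

variable [MeasurableSpace M]

/-- The measure `√(det g_{ij}) dz¹ dz²` of the domain of the chart `e`, as a measure on `M` that
vanishes outside this domain. -/
def chartVolume (e : OpenPartialHomeomorph M Plane) : Measure M :=
  ((volume.restrict e.target).withDensity
    fun z ↦ ENNReal.ofReal (Real.sqrt (gram e z).det)).map e.symm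

variable (M) in
/-- The Riemannian volume measure `dV_g`. The measures `chartVolume e` agree on the overlaps of
the charts, so that their least upper bound is the measure that restricts to `chartVolume e` on
the domain of every chart `e`. -/
def riemVolume : Measure M :=
  ⨆ e ∈ atlas Plane M, chartVolume e

/-- The vector field `G` is a weak gradient of `u`: in every chart, the weak partial derivative of
`u` in the coordinate direction `v` is `⟨G, v¹ ∂₁ + v² ∂₂⟩_g`. -/
def IsWeakGradient (u : M → ℝ) (G : ∀ x : M, TangentSpace (𝓡 2) x) : Prop :=
  ∀ e ∈ atlas Plane M,
    LocallyIntegrableOn (fun z ↦ u (e.symm z)) e.target ∧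
    ∀ v : Plane,
      LocallyIntegrableOn (fun z ↦ inner ℝ (G (e.symm z)) (coordVec e z v)) e.target ∧
      ∀ η : Plane → ℝ, ContDiff ℝ ∞ η → HasCompactSupport η → tsupport η ⊆ e.target →
        ∫ z in e.target, u (e.symm z) * fderiv ℝ η z v =
          -∫ z in e.target, inner ℝ (G (e.symm z)) (coordVec e z v) * η z

/-- `u` has a square integrable weak gradient `G`. -/
def HasL2Gradient (u : M → ℝ) (G : ∀ x : M, TangentSpace (𝓡 2) x) : Prop :=
  IsWeakGradient u G ∧ MemLp (fun x ↦ ‖G x‖) 2 (riemVolume M)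

/-- The Sobolev space `H¹`. -/
def MemH1 (u : M → ℝ) : Prop :=
  MemLp u 2 (riemVolume M) ∧ ∃ G, HasL2Gradient u G

open Classical in
/-- The weak gradient `∇u`; it is unique up to null sets. (It is `0` if there is none.) -/
def grad (u : M → ℝ) : ∀ x : M, TangentSpace (𝓡 2) x :=
  if h : ∃ G, HasL2Gradient u G then h.choose else fun _ ↦ 0

/-- `Q(u₁, u₂) = (|∇u₁|² + |∇u₂|² + ∇u₁ · ∇u₂) / 3`. -/
def Q (u₁ u₂ : M → ℝ) (x : M) : ℝ :=
  1 / 3 * (‖grad u₁ x‖ ^ 2 + ‖grad u₂ x‖ ^ 2 + inner ℝ (grad u₁ x) (grad u₂ x))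

/-- The functional
`J_ρ(u₁, u₂) = ∫ Q(u₁, u₂) + ∑ᵢ ρᵢ (∫ uᵢ - log ∫ hᵢ exp uᵢ)`. -/
def J (ρ₁ ρ₂ : ℝ) (h₁ h₂ u₁ u₂ : M → ℝ) : ℝ :=
  (∫ x, Q u₁ u₂ x ∂riemVolume M) +
    (ρ₁ * ((∫ x, u₁ x ∂riemVolume M) -
        Real.log (∫ x, h₁ x * Real.exp (u₁ x) ∂riemVolume M)) +
      ρ₂ * ((∫ x, u₂ x ∂riemVolume M) -
        Real.log (∫ x, h₂ x * Real.exp (u₂ x) ∂riemVolume M)))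

end Surface

/-! ### The cone over the surface and the parameter sets -/

/-- The relation on `M × (0, ∞)` that collapses `M × [δ, ∞)` to one point. -/
def coneSetoid (M : Type*) (δ : ℝ) : Setoid (M × Ioi (0 : ℝ)) where
  r a b := a = b ∨ (δ ≤ (a.2 : ℝ) ∧ δ ≤ (b.2 : ℝ))
  iseqv :=
    { refl := fun _ ↦ Or.inl rfl
      symm := by
        rintro a b (h | h)
        · exact Or.inl h.symm
        · exact Or.inr h.symm
      trans := by
        rintro a b c (rfl | h) (rfl | h')
        · exact Or.inl rfl
        · exact Or.inr h'
        · exact Or.inr h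
        · exact Or.inr ⟨h.1, h'.2⟩ }

/-- The topological cone over `M`, as a set. -/
def Cone (M : Type*) (δ : ℝ) : Type _ := Quotient (coneSetoid M δ)

/-- The class of `(x, t)` in the cone. -/
def Cone.mk {M : Type*} (δ : ℝ) (x : M) (t : Ioi (0 : ℝ)) : Cone M δ :=
  Quotient.mk (coneSetoid M δ) (x, t)

/-- The product of two cones without its diagonal. -/
def X (M : Type*) (δ : ℝ) : Set (Cone M δ × Cone M δ) := {p | p.1 ≠ p.2}

section Parameters

variable (M : Type*) [MetricSpace M]

/-- Pairs of points of the cone below the vertex that are apart, the smaller parameter lying in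
`[ν², ν]`. -/
def Xν₁ (δ ν : ℝ) : Set (Cone M δ × Cone M δ) :=
  {p | p ∈ X M δ ∧ ∃ (x₁ x₂ : M) (t₁ t₂ : Ioi (0 : ℝ)),
    p = (Cone.mk δ x₁ t₁, Cone.mk δ x₂ t₂) ∧
    δ ^ 4 ≤ |(t₁ : ℝ) - t₂| ^ 2 + dist x₁ x₂ ^ 2 ∧
    max (t₁ : ℝ) t₂ < δ ∧ min (t₁ : ℝ) t₂ ∈ Icc (ν ^ 2) ν}

/-- Pairs consisting of the vertex of the cone and of a point whose parameter lies in
`[ν², ν]`. -/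
def Xν₂ (δ ν : ℝ) : Set (Cone M δ × Cone M δ) :=
  {p | p ∈ X M δ ∧ ∃ (x₁ x₂ : M) (t₁ t₂ : Ioi (0 : ℝ)),
    p = (Cone.mk δ x₁ t₁, Cone.mk δ x₂ t₂) ∧
    max (t₁ : ℝ) t₂ = δ ∧ min (t₁ : ℝ) t₂ ∈ Icc (ν ^ 2) ν}

/-- The parameter set `𝒳_ν`. -/
def Xν (δ ν : ℝ) : Set (Cone M δ × Cone M δ) := Xν₁ M δ ν ∪ Xν₂ M δ ν

end Parameters

/-! ### The test functions -/

/-- The parameter `t̃`: it is `1 / t` for `t ≤ δ / 2` and `-(4 / δ²) (t - δ)` for `t ≥ δ / 2`. -/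
def tilde (δ t : ℝ) : ℝ := if t ≤ δ / 2 then 1 / t else -(4 / δ ^ 2) * (t - δ)

section TestFunctions

variable {M : Type*} [MetricSpace M]

/-- The function `1 + t̃² d(x, y)²` of `y`, for the point `ϑ = (x, t)` of the cone, `t ≤ δ`. At the
vertex, which is represented by `t = δ`, one has `t̃ = 0`, and the function is `1`. -/
def bump {δ : ℝ} (ϑ : Cone M δ) (y : M) : ℝ :=
  Quotient.lift (s := coneSetoid M δ)
    (fun a : M × Ioi (0 : ℝ) ↦
      if (a.2 : ℝ) < δ then 1 + tilde δ a.2 ^ 2 * dist a.1 y ^ 2 else 1)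
    (by
      rintro a b (rfl | ⟨ha, hb⟩)
      · rfl
      · simp [not_lt.2 ha, not_lt.2 hb])
    ϑ

theorem bump_mk {δ : ℝ} (hδ : 0 < δ) (x : M) (t : Ioi (0 : ℝ)) (ht : (t : ℝ) ≤ δ) (y : M) :
    bump (Cone.mk δ x t) y = 1 + tilde δ t ^ 2 * dist x y ^ 2 := by
  change (if (t : ℝ) < δ then 1 + tilde δ t ^ 2 * dist x y ^ 2 else 1) = _
  split_ifs with h
  · rfl
  · have h' : (t : ℝ) = δ := le_antisymm ht (not_lt.1 h)
    have h2 : ¬ δ ≤ δ / 2 := by linarith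
    simp [h', tilde, h2]

/-- `φ₁ = log ((1 + t̃₂² d(x₂, y)²) / (1 + t̃₁² d(x₁, y)²)²)`. -/
def φ₁ {δ : ℝ} (p : Cone M δ × Cone M δ) (y : M) : ℝ :=
  Real.log (bump p.2 y / bump p.1 y ^ 2)

/-- `φ₂ = log ((1 + t̃₁² d(x₁, y)²) / (1 + t̃₂² d(x₂, y)²)²)`. -/
def φ₂ {δ : ℝ} (p : Cone M δ × Cone M δ) (y : M) : ℝ :=
  Real.log (bump p.1 y / bump p.2 y ^ 2)

end TestFunctions

end Toda

end

/-!
At small scales the metric is nearly flat, so by compactness all small balls of radius `r` have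
area between `κ' r²` and `κ r²`, for any `κ' < π < κ`. The function `log (1 + t² d(x, ·)²)` has a
gradient of length at most `min t (2 / d(x, ·))`, hence its Dirichlet energy is at most
`8κ log⁺ t + O(1)`. The bubbles indexed by `𝒳_ν` do not collide, so the mixed gradient term is
bounded and the quadratic part of `J` at `φ` is at most `8κ (log⁺ t̃₁ + log⁺ t̃₂) + O(1)`.
Moreover `∫ φᵢ - log ∫ hᵢ exp φᵢ ≤ -2 log⁺ t̃ᵢ + O(1)`, because `exp φᵢ` has mass at least of order
`(max 1 t̃ⱼ / max 1 t̃ᵢ)²`, where `j ≠ i`. Since `ρᵢ > 4π`, one can choose `κ` with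
`4κ < min ρ₁ ρ₂`; then `J` tends to `-∞` as `log⁺ t̃₁ + log⁺ t̃₂ ≥ log (1 / ν)` tends to `∞`.
-/

noncomputable section

namespace Toda

/-! ### The metric in the coordinates of a chart -/

theorem isContinuousRiemannianBundle_of_contMDiff {EB HB B : Type*}
    [NormedAddCommGroup EB] [NormedSpace ℝ EB] [TopologicalSpace HB] (IB : ModelWithCorners ℝ EB HB)
    [TopologicalSpace B] [ChartedSpace HB B] (n : ℕ∞ω)
    (F : Type*) [NormedAddCommGroup F] [NormedSpace ℝ F]
    (E : B → Type*) [TopologicalSpace (TotalSpace F E)] [∀ x, NormedAddCommGroup (E x)]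
    [∀ x, InnerProductSpace ℝ (E x)] [FiberBundle F E] [VectorBundle ℝ F E]
    [IsContMDiffRiemannianBundle IB n F E] : IsContinuousRiemannianBundle F E :=
  let ⟨g, hg, h⟩ := IsContMDiffRiemannianBundle.exists_contMDiff (IB := IB) (n := n) (E := E)
  ⟨g, hg.continuous, h⟩

section Charts

variable {M : Type*} [MetricSpace M] [ChartedSpace Plane M]
  {e e' : OpenPartialHomeomorph M Plane} {z : Plane}

theorem coordVec_add (e : OpenPartialHomeomorph M Plane) (z v w : Plane) :
    coordVec e z (v + w) = coordVec e z v + coordVec e z w :=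
  map_add (mfderiv 𝓘(ℝ, Plane) (𝓡 2) e.symm z) v w

theorem coordVec_smul (e : OpenPartialHomeomorph M Plane) (z : Plane) (c : ℝ) (v : Plane) :
    coordVec e z (c • v) = c • coordVec e z v :=
  map_smul (mfderiv 𝓘(ℝ, Plane) (𝓡 2) e.symm z) c v

section Manifold

variable [IsManifold (𝓡 2) 1 M]

/-- The isomorphism `v ↦ v¹ ∂₁ + v² ∂₂` from the coordinate plane to the tangent plane. -/
def coordEquiv (he : e ∈ atlas Plane M) (hz : z ∈ e.target) :
    Plane ≃L[ℝ] TangentSpace (𝓡 2) (e.symm z) :=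
  (mdifferentiable_of_mem_atlas (I := 𝓡 2) he).symm.mfderiv hz

theorem coordEquiv_apply (he : e ∈ atlas Plane M) (hz : z ∈ e.target) (v : Plane) :
    coordEquiv he hz v = coordVec e z v :=
  rfl

theorem contDiffAt_transition (he : e ∈ atlas Plane M) (he' : e' ∈ atlas Plane M)
    (hz : z ∈ e'.target) (hz' : e'.symm z ∈ e.source) : ContDiffAt ℝ 1 (e ∘ e'.symm) z :=
  (((contMDiffOn_of_mem_maximalAtlas (IsManifold.subset_maximalAtlas he)).contMDiffAt
    (e.open_source.mem_nhds hz')).comp z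
    ((contMDiffOn_symm_of_mem_maximalAtlas (IsManifold.subset_maximalAtlas he')).contMDiffAt
      (e'.open_target.mem_nhds hz))).contDiffAt

theorem tangentMap_transition (he : e ∈ atlas Plane M) (he' : e' ∈ atlas Plane M)
    (hz : z ∈ e'.target) (hz' : e'.symm z ∈ e.source) (v : Plane) :
    tangentMap 𝓘(ℝ, Plane) (𝓡 2) e.symm
        ⟨e (e'.symm z), fderiv ℝ (e ∘ e'.symm) z v⟩ =
      tangentMap 𝓘(ℝ, Plane) (𝓡 2) e'.symm ⟨z, v⟩ := by
  have hD : MDifferentiableAt 𝓘(ℝ, Plane) 𝓘(ℝ, Plane) (e ∘ e'.symm) z :=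
    ((contDiffAt_transition he he' hz hz').differentiableAt one_ne_zero).mdifferentiableAt
  have hS : MDifferentiableAt 𝓘(ℝ, Plane) (𝓡 2) e.symm (e (e'.symm z)) :=
    (mdifferentiable_of_mem_atlas he).mdifferentiableAt_symm (e.map_source hz')
  have hcomp : e.symm ∘ e ∘ e'.symm =ᶠ[𝓝 z] e'.symm := by
    filter_upwards [(e'.symm.continuousAt hz).preimage_mem_nhds (e.open_source.mem_nhds hz')]
      with w hw using e.left_inv hw
  have hchain := (mfderiv_comp z hS hD).symm.trans hcomp.mfderiv_eq
  rw [mfderiv_eq_fderiv] at hchain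
  exact TotalSpace.ext (e.left_inv hz')
    (heq_of_eq (congrArg (fun f : Plane →L[ℝ] Plane ↦ f v) hchain))

theorem continuousOn_tangentMap_symm (he : e ∈ atlas Plane M) :
    ContinuousOn (fun p : Plane × Plane ↦
      (⟨e.symm p.1, coordVec e p.1 p.2⟩ : TangentBundle (𝓡 2) M)) (e.target ×ˢ univ) := by
  have hsymm : ContMDiffOn 𝓘(ℝ, Plane) (𝓡 2) 1 e.symm e.target :=
    contMDiffOn_symm_of_mem_maximalAtlas (IsManifold.subset_maximalAtlas he)
  have hmk : Continuous fun p : Plane × Plane ↦ (⟨p.1, p.2⟩ : TangentBundle (𝓡 2) Plane) :=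
    (tangentBundleModelSpaceHomeomorph (𝓡 2) (H := Plane)).symm.continuous
  refine ((hsymm.continuousOn_tangentMapWithin le_rfl e.open_target.uniqueMDiffOn).comp
    hmk.continuousOn fun p hp ↦ hp.1).congr fun p hp ↦ ?_
  exact (tangentMapWithin_eq_tangentMap (p := ⟨p.1, p.2⟩) (e.open_target.uniqueMDiffOn _ hp.1)
    ((mdifferentiable_of_mem_atlas he).mdifferentiableAt_symm hp.1)).symm

end Manifold

variable [RiemannianBundle (fun x : M ↦ TangentSpace (𝓡 2) x)]

theorem gram_det_eq_sq (A : Plane →L[ℝ] Plane) (hA : ∀ v, ‖coordVec e z v‖ = ‖A v‖) :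
    (gram e z).det = A.det ^ 2 := by
  have hinner : ∀ v w, inner ℝ (coordVec e z v) (coordVec e z w) = inner ℝ (A v) (A w) := by
    intro v w
    simp only [real_inner_eq_norm_add_mul_self_sub_norm_mul_self_sub_norm_mul_self_div_two,
      ← coordVec_add, ← map_add, hA]
  let b := (EuclideanSpace.basisFun (Fin 2) ℝ).toBasis
  have hgram : gram e z =
      (LinearMap.toMatrix b b (A : Plane →ₗ[ℝ] Plane)).transpose *
        LinearMap.toMatrix b b (A : Plane →ₗ[ℝ] Plane) := by
    ext i j
    simp [gram, hinner, b, Matrix.mul_apply, LinearMap.toMatrix_apply, PiLp.inner_apply,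
      mul_comm]
  rw [hgram, Matrix.det_mul, Matrix.det_transpose, LinearMap.det_toMatrix, ← sq]

variable [IsManifold (𝓡 2) 1 M]

theorem norm_coordVec_transition (he : e ∈ atlas Plane M) (he' : e' ∈ atlas Plane M)
    (hz : z ∈ e'.target) (hz' : e'.symm z ∈ e.source) (v : Plane) :
    ‖coordVec e (e (e'.symm z)) (fderiv ℝ (e ∘ e'.symm) z v)‖ = ‖coordVec e' z v‖ :=
  congrArg (fun p : TangentBundle (𝓡 2) M ↦ ‖p.2‖) (tangentMap_transition he he' hz hz' v)

theorem exists_norm_coordVec_eq (he : e ∈ atlas Plane M) (hz : z ∈ e.target) :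
    ∃ A : Plane ≃L[ℝ] Plane, ∀ v, ‖coordVec e z v‖ = ‖A v‖ := by
  have : FiniteDimensional ℝ (TangentSpace (𝓡 2) (e.symm z)) :=
    inferInstanceAs (FiniteDimensional ℝ Plane)
  have hrank : Module.finrank ℝ (TangentSpace (𝓡 2) (e.symm z)) = 2 :=
    finrank_euclideanSpace_fin (𝕜 := ℝ) (n := 2)
  let ψ := ((stdOrthonormalBasis ℝ (TangentSpace (𝓡 2) (e.symm z))).reindex
    (finCongr hrank)).repr
  exact ⟨((coordEquiv he hz).toLinearEquiv.trans ψ.toLinearEquiv).toContinuousLinearEquiv,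
    fun v ↦ (ψ.norm_map (coordVec e z v)).symm⟩

theorem gram_det_pos (he : e ∈ atlas Plane M) (hz : z ∈ e.target) : 0 < (gram e z).det := by
  obtain ⟨A, hA⟩ := exists_norm_coordVec_eq he hz
  rw [gram_det_eq_sq (A : Plane →L[ℝ] Plane) hA]
  exact sq_pos_of_ne_zero A.toLinearEquiv.isUnit_det'.ne_zero

theorem gram_det_transition (he : e ∈ atlas Plane M) (he' : e' ∈ atlas Plane M)
    (hz : z ∈ e'.target) (hz' : e'.symm z ∈ e.source) :
    (gram e' z).det = (fderiv ℝ (e ∘ e'.symm) z).det ^ 2 * (gram e (e (e'.symm z))).det := by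
  obtain ⟨A, hA⟩ := exists_norm_coordVec_eq he (e.map_source hz')
  rw [gram_det_eq_sq (A : Plane →L[ℝ] Plane) hA,
    gram_det_eq_sq ((A : Plane →L[ℝ] Plane) ∘L fderiv ℝ (e ∘ e'.symm) z) fun v ↦ by
      rw [← norm_coordVec_transition he he' hz hz']; exact hA _, mul_comm, ← mul_pow]
  congr 1
  exact LinearMap.det_comp (A : Plane →ₗ[ℝ] Plane) _

variable [IsContinuousRiemannianBundle Plane (fun x : M ↦ TangentSpace (𝓡 2) x)]

theorem continuousOn_norm_coordVec (he : e ∈ atlas Plane M) :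
    ContinuousOn (fun p : Plane × Plane ↦ ‖coordVec e p.1 p.2‖) (e.target ×ˢ univ) := by
  have h := continuousOn_tangentMap_symm he
  refine (h.inner_bundle h).sqrt.congr fun p _ ↦ ?_
  simp only [real_inner_self_eq_norm_sq, Real.sqrt_sq (norm_nonneg _)]

theorem continuousOn_inner_coordVec (he : e ∈ atlas Plane M) (v w : Plane) :
    ContinuousOn (fun z ↦ inner ℝ (coordVec e z v) (coordVec e z w)) e.target :=
  have h (v : Plane) := (continuousOn_tangentMap_symm he).comp
    (Continuous.prodMk_left v).continuousOn fun _ hz ↦ ⟨hz, mem_univ v⟩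
  (h v).inner_bundle (h w)

theorem continuousOn_sqrt_gram_det (he : e ∈ atlas Plane M) :
    ContinuousOn (fun z ↦ √(gram e z).det) e.target := by
  simp only [Matrix.det_fin_two]
  have h (i j : Fin 2) : ContinuousOn (fun z ↦ gram e z i j) e.target :=
    continuousOn_inner_coordVec he _ _
  exact (((h 0 0).mul (h 1 1)).sub ((h 0 1).mul (h 1 0))).sqrt

/-- On `s`, the metric in the coordinates of `e` is comparable with the constant metric `‖A ·‖`,
with constants `1 ± ε`; this is recorded for the lengths of vectors and for the density of the
volume. -/
structure AlmostFlat (e : OpenPartialHomeomorph M Plane) (A : Plane ≃L[ℝ] Plane) (ε : ℝ)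
    (s : Set Plane) : Prop where
  subset_target : s ⊆ e.target
  le_norm : ∀ z ∈ s, ∀ v, (1 - ε) * ‖A v‖ ≤ ‖coordVec e z v‖
  norm_le : ∀ z ∈ s, ∀ v, ‖coordVec e z v‖ ≤ (1 + ε) * ‖A v‖
  le_density : ∀ z ∈ s, (1 - ε) * |(A : Plane →L[ℝ] Plane).det| ≤ √(gram e z).det
  density_le : ∀ z ∈ s, √(gram e z).det ≤ (1 + ε) * |(A : Plane →L[ℝ] Plane).det|

theorem exists_almostFlat (he : e ∈ atlas Plane M) (hz : z ∈ e.target) {ε : ℝ} (hε : 0 < ε) :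
    ∃ A : Plane ≃L[ℝ] Plane, ∃ s > 0, AlmostFlat e A ε (Metric.ball z s) := by
  obtain ⟨A, hA⟩ := exists_norm_coordVec_eq he hz
  have hdet : 0 < |(A : Plane →L[ℝ] Plane).det| := abs_pos.2 A.toLinearEquiv.isUnit_det'.ne_zero
  have hnorm : ∀ᶠ w in 𝓝 z, ∀ v ∈ A ⁻¹' Metric.sphere 0 1,
      ‖coordVec e w v‖ ∈ Ioo (1 - ε) (1 + ε) := by
    refine (A.toHomeomorph.isCompact_preimage.2
      (isCompact_sphere 0 1)).eventually_forall_of_forall_eventually fun v hv ↦ ?_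
    have hone : ‖coordVec e z v‖ = 1 := by rw [hA]; simpa using hv
    exact ((continuousOn_norm_coordVec he).continuousAt
      (prod_mem_nhds (e.open_target.mem_nhds hz) univ_mem)).eventually_mem
      (Ioo_mem_nhds (by simp only [hone]; linarith) (by simp only [hone]; linarith))
  have hdensity : ∀ᶠ w in 𝓝 z, √(gram e w).det ∈
      Ioo ((1 - ε) * |(A : Plane →L[ℝ] Plane).det|)
        ((1 + ε) * |(A : Plane →L[ℝ] Plane).det|) := by
    refine ((continuousOn_sqrt_gram_det he).continuousAt
      (e.open_target.mem_nhds hz)).eventually_mem (Ioo_mem_nhds ?_ ?_) <;>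
    · rw [gram_det_eq_sq (A : Plane →L[ℝ] Plane) hA, Real.sqrt_sq_eq_abs]
      nlinarith
  obtain ⟨s, hs, hball⟩ := Metric.eventually_nhds_iff_ball.1
    ((e.open_target.eventually_mem hz).and (hnorm.and hdensity))
  have hscale (w : Plane) (hw : w ∈ Metric.ball z s) (v : Plane) :
      (1 - ε) * ‖A v‖ ≤ ‖coordVec e w v‖ ∧ ‖coordVec e w v‖ ≤ (1 + ε) * ‖A v‖ := by
    obtain rfl | hv := eq_or_ne v 0
    · simp [← coordEquiv_apply he (hball w hw).1]
    have hAv : 0 < ‖A v‖ := norm_pos_iff.2 (A.map_ne_zero_iff.2 hv)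
    have h := (hball w hw).2.1 (‖A v‖⁻¹ • v) (by simp [norm_smul, hAv.ne'])
    rw [coordVec_smul, norm_smul, norm_inv, norm_norm, inv_mul_eq_div, mem_Ioo, lt_div_iff₀ hAv,
      div_lt_iff₀ hAv] at h
    exact ⟨h.1.le, h.2.le⟩
  exact ⟨A, s, hs, fun w hw ↦ (hball w hw).1, fun w hw v ↦ (hscale w hw v).1,
    fun w hw v ↦ (hscale w hw v).2, fun w hw ↦ (hball w hw).2.2.1.le,
    fun w hw ↦ (hball w hw).2.2.2.le⟩

end Charts

/-! ### The Riemannian distance in the coordinates of a chart -/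

section Distance

variable {M : Type*} [MetricSpace M] [ChartedSpace Plane M]
  [RiemannianBundle (fun x : M ↦ TangentSpace (𝓡 2) x)]
  {e : OpenPartialHomeomorph M Plane}

theorem exists_path_of_dist_lt [IsRiemannianManifold (𝓡 2) M] {x y : M} {r : ℝ} (h : dist x y < r) :
    ∃ γ : ℝ → M, ContMDiff 𝓘(ℝ, ℝ) (𝓡 2) 1 γ ∧ γ 0 = x ∧ γ 1 = y ∧
      pathELength (𝓡 2) γ 0 1 < ENNReal.ofReal r ∧ ∀ t ∈ Icc (0 : ℝ) 1, dist x (γ t) < r := by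
  have hr : 0 < r := dist_nonneg.trans_lt h
  rw [← ENNReal.ofReal_lt_ofReal_iff hr, ← edist_dist, IsRiemannianManifold.out (I := 𝓡 2)] at h
  obtain ⟨γ, hγ0, hγ1, hγ, hlen, -⟩ :=
    exists_lt_locally_constant_of_riemannianEDist_lt h zero_lt_one
  refine ⟨γ, hγ, hγ0, hγ1, hlen, fun t ht ↦ ?_⟩
  rw [← ENNReal.ofReal_lt_ofReal_iff hr, ← edist_dist, IsRiemannianManifold.out (I := 𝓡 2)]
  exact ((riemannianEDist_le_pathELength hγ.contMDiffOn hγ0 rfl ht.1).trans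
    (pathELength_mono le_rfl ht.2)).trans_lt hlen

variable [IsManifold (𝓡 2) 1 M]

theorem pathELength_symm_comp (he : e ∈ atlas Plane M) {c : ℝ → Plane}
    (hc : ContDiffOn ℝ 1 c (Icc 0 1)) (hmem : MapsTo c (Icc 0 1) e.target) :
    pathELength (𝓡 2) (e.symm ∘ c) 0 1 =
      ∫⁻ t in Icc (0 : ℝ) 1, ‖coordVec e (c t) (derivWithin c (Icc 0 1) t)‖ₑ := by
  rw [pathELength_eq_lintegral_mfderivWithin_Icc]
  refine setLIntegral_congr_fun measurableSet_Icc fun t ht ↦ ?_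
  have hchain := mfderiv_comp_mfderivWithin (I := 𝓘(ℝ, ℝ)) t
    ((mdifferentiable_of_mem_atlas (I := 𝓡 2) he).mdifferentiableAt_symm (hmem ht))
    ((hc.differentiableOn one_ne_zero).mdifferentiableOn t ht)
    ((uniqueDiffOn_Icc zero_lt_one).uniqueMDiffOn t ht)
  rw [mfderivWithin_eq_fderivWithin] at hchain
  exact congrArg (fun f : ℝ →L[ℝ] TangentSpace (𝓡 2) (e.symm (c t)) ↦ ‖f 1‖ₑ) hchain

theorem AlmostFlat.le_pathELength {A : Plane ≃L[ℝ] Plane} {ε : ℝ} {s : Set Plane}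
    (h : AlmostFlat e A ε s) (he : e ∈ atlas Plane M) (hε : ε ≤ 1) {c : ℝ → Plane}
    (hc : ContDiffOn ℝ 1 c (Icc 0 1)) (hmem : MapsTo c (Icc 0 1) s) :
    ENNReal.ofReal ((1 - ε) * ‖A (c 1 - c 0)‖) ≤ pathELength (𝓡 2) (e.symm ∘ c) 0 1 := by
  let B : Plane →L[ℝ] Plane := (1 - ε) • (A : Plane →L[ℝ] Plane)
  have hB (v : Plane) : ‖B v‖ₑ = ENNReal.ofReal ((1 - ε) * ‖A v‖) := by
    simp [B, ← ofReal_norm, norm_smul, abs_of_nonneg (sub_nonneg.2 hε)]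
  calc ENNReal.ofReal ((1 - ε) * ‖A (c 1 - c 0)‖)
      = ‖(B ∘ c) 1 - (B ∘ c) 0‖ₑ := by rw [← hB, map_sub]; rfl
    _ ≤ ∫⁻ t in Icc (0 : ℝ) 1, ‖derivWithin (B ∘ c) (Icc 0 1) t‖ₑ :=
      enorm_sub_le_lintegral_derivWithin_Icc_of_contDiffOn_Icc
        (B.contDiff.comp_contDiffOn hc) zero_le_one
    _ ≤ ∫⁻ t in Icc (0 : ℝ) 1, ‖coordVec e (c t) (derivWithin c (Icc 0 1) t)‖ₑ := by
      refine setLIntegral_mono' measurableSet_Icc fun t ht ↦ ?_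
      have hderiv := (B.hasFDerivAt.comp_hasDerivWithinAt t
        (hc.differentiableOn one_ne_zero t ht).hasDerivWithinAt).derivWithin
        (uniqueDiffOn_Icc zero_lt_one t ht)
      rw [hderiv, hB, ← ofReal_norm]
      exact ENNReal.ofReal_le_ofReal (h.le_norm _ (hmem ht) _)
    _ = pathELength (𝓡 2) (e.symm ∘ c) 0 1 :=
      (pathELength_symm_comp he hc fun t ht ↦ h.subset_target (hmem ht)).symm

variable [IsRiemannianManifold (𝓡 2) M]

theorem dist_symm_le (he : e ∈ atlas Plane M) {z w : Plane} {C : ℝ} (hC : 0 ≤ C)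
    (hseg : segment ℝ z w ⊆ e.target) (h : ∀ p ∈ segment ℝ z w, ‖coordVec e p (w - z)‖ ≤ C) :
    dist (e.symm z) (e.symm w) ≤ C := by
  let c : ℝ → Plane := AffineMap.lineMap z w
  have hmem : ∀ t ∈ Icc (0 : ℝ) 1, c t ∈ segment ℝ z w := fun t ht ↦
    segment_eq_image_lineMap ℝ z w ▸ mem_image_of_mem _ ht
  have hc : ContDiffOn ℝ 1 c (Icc 0 1) :=
    (ContinuousAffineMap.lineMap (R := ℝ) z w).contDiff.contDiffOn
  have hderiv (t : ℝ) (ht : t ∈ Icc (0 : ℝ) 1) : derivWithin c (Icc 0 1) t = w - z :=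
    AffineMap.hasDerivAt_lineMap.hasDerivWithinAt.derivWithin (uniqueDiffOn_Icc zero_lt_one t ht)
  have hsmooth : ContMDiffOn 𝓘(ℝ, ℝ) (𝓡 2) 1 (e.symm ∘ c) (Icc 0 1) :=
    (contMDiffOn_symm_of_mem_maximalAtlas (IsManifold.subset_maximalAtlas he)).comp
      hc.contMDiffOn fun t ht ↦ hseg (hmem t ht)
  rw [← ENNReal.ofReal_le_ofReal_iff hC, ← edist_dist, IsRiemannianManifold.out (I := 𝓡 2)]
  calc riemannianEDist (𝓡 2) (e.symm z) (e.symm w)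
      ≤ pathELength (𝓡 2) (e.symm ∘ c) 0 1 :=
      riemannianEDist_le_pathELength hsmooth (by simp [c]) (by simp [c]) zero_le_one
    _ = ∫⁻ t in Icc (0 : ℝ) 1, ‖coordVec e (c t) (derivWithin c (Icc 0 1) t)‖ₑ :=
      pathELength_symm_comp he hc fun t ht ↦ hseg (hmem t ht)
    _ ≤ ∫⁻ _ in Icc (0 : ℝ) 1, ENNReal.ofReal C := by
      refine setLIntegral_mono' measurableSet_Icc fun t ht ↦ ?_
      rw [hderiv t ht, ← ofReal_norm]
      exact ENNReal.ofReal_le_ofReal (h _ (hmem t ht))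
    _ = ENNReal.ofReal C := by simp

-- A nearly shortest path between two points of the ball of radius `R` stays in the one of
-- radius `3 * R`.
theorem AlmostFlat.le_dist {A : Plane ≃L[ℝ] Plane} {ε : ℝ} {s : Set Plane}
    (h : AlmostFlat e A ε s) (he : e ∈ atlas Plane M) (hε : ε ≤ 1) {p x y : M} {R : ℝ}
    (hsub : Metric.ball p (3 * R) ⊆ e.source ∩ e ⁻¹' s)
    (hx : x ∈ Metric.ball p R) (hy : y ∈ Metric.ball p R) :
    (1 - ε) * ‖A (e y - e x)‖ ≤ dist x y := by
  rw [Metric.mem_ball] at hx hy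
  have hxy : dist x y < 2 * R := by linarith [dist_triangle_right x y p]
  suffices ∀ r, dist x y < r → r < 2 * R → (1 - ε) * ‖A (e y - e x)‖ ≤ r by
    refine le_of_forall_gt_imp_ge_of_dense fun r hr ↦ ?_
    obtain ⟨r', hr', hlt⟩ := exists_between (lt_min hr hxy)
    exact (this r' hr' (hlt.trans_le (min_le_right _ _))).trans (hlt.le.trans (min_le_left _ _))
  intro r hr hrR
  obtain ⟨γ, hγ, rfl, rfl, hlen, hγr⟩ := exists_path_of_dist_lt hr
  have hmem : ∀ t ∈ Icc (0 : ℝ) 1, γ t ∈ e.source ∩ e ⁻¹' s := fun t ht ↦ hsub (by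
    rw [Metric.mem_ball]
    linarith [hγr t ht, dist_triangle_left (γ t) p (γ 0)])
  have hc : ContDiffOn ℝ 1 (e ∘ γ) (Icc 0 1) :=
    ((contMDiffOn_of_mem_maximalAtlas (IsManifold.subset_maximalAtlas he)).comp
      hγ.contMDiffOn fun t ht ↦ (hmem t ht).1).contDiffOn
  have hcongr : pathELength (𝓡 2) (e.symm ∘ e ∘ γ) 0 1 = pathELength (𝓡 2) γ 0 1 :=
    pathELength_congr fun t ht ↦ e.left_inv (hmem t ht).1
  exact (ENNReal.ofReal_le_ofReal_iff (dist_nonneg.trans hr.le)).1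
    ((h.le_pathELength he hε hc fun t ht ↦ (hmem t ht).2).trans (hcongr.trans_lt hlen).le)

end Distance

/-! ### The Riemannian volume in the coordinates of a chart -/

theorem measurableSet_inter_preimage {α β : Type*} [TopologicalSpace α] [MeasurableSpace α]
    [OpensMeasurableSpace α] [TopologicalSpace β] [MeasurableSpace β] [BorelSpace β]
    {f : α → β} {t : Set α} {s : Set β} (hf : ContinuousOn f t) (ht : MeasurableSet t)
    (hs : MeasurableSet s) : MeasurableSet (t ∩ f ⁻¹' s) := by
  have h := ht.subtype_image (hf.domRestrict.measurable hs)
  rwa [domRestrict_eq, preimage_comp, Subtype.image_preimage_coe] at h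

theorem volume_norm_sub_lt (A : Plane ≃L[ℝ] Plane) (w : Plane) {r : ℝ} (hr : 0 ≤ r) :
    volume {z | ‖A (z - w)‖ < r} =
      ENNReal.ofReal (|(A : Plane →L[ℝ] Plane).det|⁻¹ * (Real.pi * r ^ 2)) := by
  have hpre : {z | ‖A (z - w)‖ < r} = A ⁻¹' Metric.ball (A w) r := by
    ext z
    simp [dist_eq_norm]
  have hdet : LinearMap.det (A.symm : Plane →ₗ[ℝ] Plane) = (A : Plane →L[ℝ] Plane).det⁻¹ :=
    A.toLinearEquiv.det_coe_symm
  rw [hpre, Measure.addHaar_preimage_continuousLinearEquiv, hdet,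
    EuclideanSpace.volume_ball_fin_two, ← ENNReal.ofReal_pow hr,
    ← ENNReal.ofReal_mul (by positivity), ← ENNReal.ofReal_mul (abs_nonneg _), abs_inv,
    mul_comm Real.pi]

section Volume

variable {M : Type*} [MetricSpace M] [ChartedSpace Plane M]
  [RiemannianBundle (fun x : M ↦ TangentSpace (𝓡 2) x)]
  [MeasurableSpace M] [BorelSpace M] {e e' : OpenPartialHomeomorph M Plane}

theorem chartVolume_apply (e : OpenPartialHomeomorph M Plane) {S : Set M} (hS : MeasurableSet S) :
    chartVolume e S =
      ∫⁻ z in e.target ∩ e.symm ⁻¹' S, ENNReal.ofReal (√(gram e z).det) := by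
  have hmeas : AEMeasurable e.symm ((volume.restrict e.target).withDensity
      fun z ↦ ENNReal.ofReal (√(gram e z).det)) :=
    (e.continuousOn_symm.aemeasurable e.open_target.measurableSet).mono_ac
      (withDensity_absolutelyContinuous _ _)
  rw [chartVolume, Measure.map_apply_of_aemeasurable hmeas hS, withDensity_apply',
    Measure.restrict_restrict' e.open_target.measurableSet, inter_comm]

theorem chartVolume_restrict_source (e : OpenPartialHomeomorph M Plane) :
    (chartVolume e).restrict e.source = chartVolume e := by
  refine Measure.restrict_eq_self_of_ae_mem (ae_iff.2 ?_)
  have hempty : e.target ∩ e.symm ⁻¹' e.sourceᶜ = ∅ :=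
    eq_empty_of_forall_notMem fun z hz ↦ hz.2 (e.map_target hz.1)
  change chartVolume e e.sourceᶜ = 0
  rw [chartVolume_apply e e.open_source.measurableSet.compl, hempty, Measure.restrict_empty,
    lintegral_zero_measure]

variable [IsManifold (𝓡 2) 1 M]

theorem chartVolume_le_of_subset (he : e ∈ atlas Plane M) (he' : e' ∈ atlas Plane M) {S : Set M}
    (hS : MeasurableSet S) (hsub : S ⊆ e.source) : chartVolume e' S ≤ chartVolume e S := by
  let s := e'.target ∩ e'.symm ⁻¹' S
  have hs : MeasurableSet s :=
    measurableSet_inter_preimage e'.continuousOn_symm e'.open_target.measurableSet hS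
  have hinj : InjOn (e ∘ e'.symm) s := fun z hz w hw h ↦
    e'.symm.injOn hz.1 hw.1 (e.injOn (hsub hz.2) (hsub hw.2) h)
  have himage : (e ∘ e'.symm) '' s ⊆ e.target ∩ e.symm ⁻¹' S := by
    rintro _ ⟨z, hz, rfl⟩
    refine ⟨e.map_source (hsub hz.2), ?_⟩
    rw [mem_preimage, Function.comp_apply, e.left_inv (hsub hz.2)]
    exact hz.2
  have hderiv : ∀ z ∈ s,
      HasFDerivWithinAt (e ∘ e'.symm) (fderiv ℝ (e ∘ e'.symm) z) s z := fun z hz ↦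
    ((contDiffAt_transition he he' hz.1
      (hsub hz.2)).differentiableAt one_ne_zero).hasFDerivAt.hasFDerivWithinAt
  calc chartVolume e' S
      = ∫⁻ z in s, ENNReal.ofReal (√(gram e' z).det) := chartVolume_apply e' hS
    _ = ∫⁻ z in s, ENNReal.ofReal |(fderiv ℝ (e ∘ e'.symm) z).det| *
          ENNReal.ofReal (√(gram e ((e ∘ e'.symm) z)).det) := by
      refine setLIntegral_congr_fun hs fun z hz ↦ ?_
      dsimp only [Function.comp_apply]
      rw [gram_det_transition he he' hz.1 (hsub hz.2), Real.sqrt_mul (sq_nonneg _),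
        Real.sqrt_sq_eq_abs, ENNReal.ofReal_mul (abs_nonneg _)]
    _ = ∫⁻ z in (e ∘ e'.symm) '' s, ENNReal.ofReal (√(gram e z).det) :=
      (lintegral_image_eq_lintegral_abs_det_fderiv_mul volume hs hderiv hinj
        fun z ↦ ENNReal.ofReal (√(gram e z).det)).symm
    _ ≤ ∫⁻ z in e.target ∩ e.symm ⁻¹' S, ENNReal.ofReal (√(gram e z).det) :=
      lintegral_mono_set himage
    _ = chartVolume e S := (chartVolume_apply e hS).symm

theorem riemVolume_restrict_source (he : e ∈ atlas Plane M) :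
    (riemVolume M).restrict e.source = chartVolume e := by
  have hmeas := e.open_source.measurableSet
  have hle : ∀ e' ∈ atlas Plane M, chartVolume e' ≤ riemVolume M := fun e' he' ↦
    le_iSup₂ (f := fun e (_ : e ∈ atlas Plane M) ↦ chartVolume e) e' he'
  have hsum : riemVolume M ≤ chartVolume e + (riemVolume M).restrict e.sourceᶜ := by
    refine iSup₂_le fun e' he' ↦ ?_
    rw [← Measure.restrict_add_restrict_compl (μ := chartVolume e') hmeas]
    refine add_le_add (Measure.le_iff.2 fun S hS ↦ ?_)
      (Measure.restrict_mono_measure (hle e' he') _)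
    rw [Measure.restrict_apply hS]
    exact (chartVolume_le_of_subset he he' (hS.inter hmeas) inter_subset_right).trans
      (measure_mono inter_subset_left)
  refine le_antisymm ?_ ?_
  · simpa [Measure.restrict_restrict hmeas, chartVolume_restrict_source]
      using Measure.restrict_mono_measure hsum e.source
  · simpa [chartVolume_restrict_source] using Measure.restrict_mono_measure (hle e he) e.source

theorem riemVolume_apply_of_subset (he : e ∈ atlas Plane M) {S : Set M}
    (hS : MeasurableSet S) (hsub : S ⊆ e.source) :
    riemVolume M S =
      ∫⁻ z in e.target ∩ e.symm ⁻¹' S, ENNReal.ofReal (√(gram e z).det) := by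
  rw [← chartVolume_apply e hS, ← riemVolume_restrict_source he, Measure.restrict_apply hS,
    inter_eq_left.2 hsub]

variable [IsRiemannianManifold (𝓡 2) M]

theorem AlmostFlat.riemVolume_ball_le {A : Plane ≃L[ℝ] Plane} {ε : ℝ} {s : Set Plane}
    (h : AlmostFlat e A ε s) (he : e ∈ atlas Plane M) (hε : 0 ≤ ε) (hε1 : ε < 1) {p x : M}
    {R r : ℝ} (hr : 0 < r) (hsub : Metric.ball p (3 * R) ⊆ e.source ∩ e ⁻¹' s)
    (hxr : Metric.ball x r ⊆ Metric.ball p R) :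
    riemVolume M (Metric.ball x r) ≤
      ENNReal.ofReal ((1 + ε) / (1 - ε) ^ 2 * Real.pi * r ^ 2) := by
  have hε' : 0 < 1 - ε := sub_pos.2 hε1
  have hdet : 0 < |(A : Plane →L[ℝ] Plane).det| := abs_pos.2 A.toLinearEquiv.isUnit_det'.ne_zero
  have hx : x ∈ Metric.ball p R := hxr (Metric.mem_ball_self hr)
  have hR : 0 < R := Metric.pos_of_mem_ball hx
  have hball : Metric.ball x r ⊆ e.source ∩ e ⁻¹' s :=
    (hxr.trans (Metric.ball_subset_ball (by linarith))).trans hsub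
  have hdisc : e.target ∩ e.symm ⁻¹' Metric.ball x r ⊆ {z | ‖A (z - e x)‖ < r / (1 - ε)} := by
    rintro z ⟨hz, hzx⟩
    have hdist := h.le_dist he hε1.le hsub hx (hxr hzx)
    rw [e.right_inv hz] at hdist
    exact (lt_div_iff₀' hε').2 (hdist.trans_lt (Metric.mem_ball'.1 hzx))
  calc riemVolume M (Metric.ball x r)
      = ∫⁻ z in e.target ∩ e.symm ⁻¹' Metric.ball x r, ENNReal.ofReal (√(gram e z).det) :=
      riemVolume_apply_of_subset he Metric.isOpen_ball.measurableSet fun y hy ↦ (hball hy).1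
    _ ≤ ∫⁻ _ in e.target ∩ e.symm ⁻¹' Metric.ball x r,
          ENNReal.ofReal ((1 + ε) * |(A : Plane →L[ℝ] Plane).det|) := by
      refine setLIntegral_mono' (measurableSet_inter_preimage e.continuousOn_symm
        e.open_target.measurableSet Metric.isOpen_ball.measurableSet) fun z hz ↦ ?_
      have hzs : e (e.symm z) ∈ s := (hball hz.2).2
      rw [e.right_inv hz.1] at hzs
      exact ENNReal.ofReal_le_ofReal (h.density_le z hzs)
    _ ≤ ENNReal.ofReal ((1 + ε) * |(A : Plane →L[ℝ] Plane).det|) *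
          volume {z | ‖A (z - e x)‖ < r / (1 - ε)} := by
      rw [setLIntegral_const]
      gcongr
    _ = ENNReal.ofReal ((1 + ε) / (1 - ε) ^ 2 * Real.pi * r ^ 2) := by
      rw [volume_norm_sub_lt A _ (by positivity), ← ENNReal.ofReal_mul (by positivity)]
      congr 1
      field_simp

theorem AlmostFlat.le_riemVolume_ball {A : Plane ≃L[ℝ] Plane} {ε : ℝ} {s : Set Plane}
    (h : AlmostFlat e A ε s) (he : e ∈ atlas Plane M) (hε : 0 ≤ ε) (hε1 : ε ≤ 1)
    (hs : Convex ℝ s) {x : M} (hx : x ∈ e.source) {r : ℝ} (hr : 0 < r)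
    (hdisc : {z | ‖A (z - e x)‖ < r / (1 + ε)} ⊆ s) :
    ENNReal.ofReal ((1 - ε) / (1 + ε) ^ 2 * Real.pi * r ^ 2) ≤
      riemVolume M (Metric.ball x r) := by
  have : 0 ≤ 1 - ε := sub_nonneg.2 hε1
  have hdet : 0 < |(A : Plane →L[ℝ] Plane).det| := abs_pos.2 A.toLinearEquiv.isUnit_det'.ne_zero
  have hxs : e x ∈ s := hdisc (by
    simp only [mem_ofPred_eq, sub_self, map_zero, norm_zero]
    positivity)
  have hsub : {z | ‖A (z - e x)‖ < r / (1 + ε)} ⊆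
      e.target ∩ e.symm ⁻¹' (Metric.ball x r ∩ e.source) := by
    intro z hz
    have hseg := hs.segment_subset hxs (hdisc hz)
    have hzt := h.subset_target (hdisc hz)
    have hdist := dist_symm_le he (C := (1 + ε) * ‖A (z - e x)‖) (by positivity)
      (hseg.trans h.subset_target) fun w hw ↦ h.norm_le w (hseg hw) _
    rw [e.left_inv hx] at hdist
    exact ⟨hzt, Metric.mem_ball'.2 (hdist.trans_lt ((lt_div_iff₀' (by positivity)).1 hz)),
      e.map_target hzt⟩
  calc ENNReal.ofReal ((1 - ε) / (1 + ε) ^ 2 * Real.pi * r ^ 2)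
      = ENNReal.ofReal ((1 - ε) * |(A : Plane →L[ℝ] Plane).det|) *
          volume {z | ‖A (z - e x)‖ < r / (1 + ε)} := by
        rw [volume_norm_sub_lt A _ (by positivity), ← ENNReal.ofReal_mul (by positivity)]
        congr 1
        field_simp
    _ = ∫⁻ _ in {z | ‖A (z - e x)‖ < r / (1 + ε)},
          ENNReal.ofReal ((1 - ε) * |(A : Plane →L[ℝ] Plane).det|) :=
      (setLIntegral_const _ _).symm
    _ ≤ ∫⁻ z in {z | ‖A (z - e x)‖ < r / (1 + ε)}, ENNReal.ofReal (√(gram e z).det) :=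
      setLIntegral_mono' (isOpen_lt (by fun_prop) continuous_const).measurableSet fun z hz ↦
        ENNReal.ofReal_le_ofReal (h.le_density z (hdisc hz))
    _ ≤ ∫⁻ z in e.target ∩ e.symm ⁻¹' (Metric.ball x r ∩ e.source),
          ENNReal.ofReal (√(gram e z).det) := lintegral_mono_set hsub
    _ = riemVolume M (Metric.ball x r ∩ e.source) :=
      (riemVolume_apply_of_subset he (Metric.isOpen_ball.inter e.open_source).measurableSet
        inter_subset_right).symm
    _ ≤ riemVolume M (Metric.ball x r) := measure_mono inter_subset_left

end Volume

/-! ### Small balls -/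

/-- Balls of radius at most `R` have measure at most `κ r²`. -/
def UpperRegular {M : Type*} [MetricSpace M] [MeasurableSpace M] (μ : Measure M) (κ R : ℝ) :
    Prop :=
  ∀ x r, 0 < r → r ≤ R → μ (Metric.ball x r) ≤ ENNReal.ofReal (κ * r ^ 2)

/-- Balls of radius at most `R` have measure at least `κ r²`. -/
def LowerRegular {M : Type*} [MetricSpace M] [MeasurableSpace M] (μ : Measure M) (κ R : ℝ) :
    Prop :=
  ∀ x r, 0 < r → r ≤ R → ENNReal.ofReal (κ * r ^ 2) ≤ μ (Metric.ball x r)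

theorem exists_forall_of_eventually_nhdsGT_prod_nhds {M : Type*} [TopologicalSpace M]
    [CompactSpace M] {P : ℝ → M → Prop}
    (h : ∀ p, ∀ᶠ q in 𝓝[>] (0 : ℝ) ×ˢ 𝓝 p, P q.1 q.2) :
    ∃ R > 0, ∀ x r, 0 < r → r ≤ R → P r x := by
  have hmem : {q : ℝ × M | P q.1 q.2} ∈ 𝓝[>] (0 : ℝ) ×ˢ 𝓝ˢ (univ : Set M) :=
    isCompact_univ.mem_prod_nhdsSet_of_forall fun p _ ↦ h p
  rw [nhdsSet_univ, mem_prod_top, mem_nhdsGT_iff_exists_Ioc_subset] at hmem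
  obtain ⟨R, hR, hsub⟩ := hmem
  exact ⟨R, hR, fun x r hr hrR ↦ hsub ⟨hr, hrR⟩ x⟩

section SmallBalls

variable {M : Type*} [MetricSpace M] [ChartedSpace Plane M] [IsManifold (𝓡 2) 1 M]
  [RiemannianBundle (fun x : M ↦ TangentSpace (𝓡 2) x)]
  [IsContinuousRiemannianBundle Plane (fun x : M ↦ TangentSpace (𝓡 2) x)]
  [IsRiemannianManifold (𝓡 2) M] [MeasurableSpace M] [BorelSpace M]

theorem eventually_riemVolume_ball_le (p : M) {κ : ℝ} (hκ : Real.pi < κ) :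
    ∀ᶠ q in 𝓝[>] (0 : ℝ) ×ˢ 𝓝 p,
      riemVolume M (Metric.ball q.2 q.1) ≤ ENNReal.ofReal (κ * q.1 ^ 2) := by
  have hlim : Tendsto (fun ε : ℝ ↦ (1 + ε) / (1 - ε) ^ 2 * Real.pi) (𝓝[>] 0) (𝓝 Real.pi) := by
    have hcont : ContinuousAt (fun ε : ℝ ↦ (1 + ε) / (1 - ε) ^ 2 * Real.pi) 0 := by
      fun_prop (disch := norm_num)
    simpa [ContinuousAt] using hcont.mono_left nhdsWithin_le_nhds
  obtain ⟨ε, hεκ, hε, hε1⟩ :=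
    ((hlim.eventually_lt_const hκ).and (Ioo_mem_nhdsGT one_pos)).exists
  have he := chart_mem_atlas Plane p
  have hp := mem_chart_source Plane p
  obtain ⟨A, s, hs, hflat⟩ := exists_almostFlat he ((chartAt Plane p).map_source hp) hε
  obtain ⟨R, hR, hsub⟩ := Metric.mem_nhds_iff.1
    (inter_mem ((chartAt Plane p).open_source.mem_nhds hp)
      (((chartAt Plane p).continuousAt hp).preimage_mem_nhds (Metric.ball_mem_nhds _ hs)))
  have hsmall : ∀ᶠ q in 𝓝[>] (0 : ℝ) ×ˢ 𝓝 p, q.1 + dist q.2 p < R / 3 := by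
    have hfst : Tendsto Prod.fst (𝓝[>] (0 : ℝ) ×ˢ 𝓝 p) (𝓝 0) :=
      tendsto_fst.mono_right nhdsWithin_le_nhds
    have := hfst.add (tendsto_iff_dist_tendsto_zero.1 tendsto_snd)
    exact this.eventually_lt_const (by simpa using by positivity)
  filter_upwards [hsmall, tendsto_fst.eventually self_mem_nhdsWithin] with q hq hq0
  refine (hflat.riemVolume_ball_le he hε.le hε1 (R := R / 3) hq0 ?_
    (Metric.ball_subset_ball' hq.le)).trans (ENNReal.ofReal_le_ofReal (by gcongr))
  rwa [mul_div_cancel₀ R three_ne_zero]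

theorem eventually_le_riemVolume_ball (p : M) {κ : ℝ} (hκ : κ < Real.pi) :
    ∀ᶠ q in 𝓝[>] (0 : ℝ) ×ˢ 𝓝 p,
      ENNReal.ofReal (κ * q.1 ^ 2) ≤ riemVolume M (Metric.ball q.2 q.1) := by
  have hlim : Tendsto (fun ε : ℝ ↦ (1 - ε) / (1 + ε) ^ 2 * Real.pi) (𝓝[>] 0) (𝓝 Real.pi) := by
    have hcont : ContinuousAt (fun ε : ℝ ↦ (1 - ε) / (1 + ε) ^ 2 * Real.pi) 0 := by
      fun_prop (disch := norm_num)
    simpa [ContinuousAt] using hcont.mono_left nhdsWithin_le_nhds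
  obtain ⟨ε, hεκ, hε, hε1⟩ :=
    ((hlim.eventually_const_lt hκ).and (Ioo_mem_nhdsGT one_pos)).exists
  set e := chartAt Plane p
  have he : e ∈ atlas Plane M := chart_mem_atlas Plane p
  have hp : p ∈ e.source := mem_chart_source Plane p
  obtain ⟨A, s, hs, hflat⟩ := exists_almostFlat he (e.map_source hp) hε
  have hsmall : ∀ᶠ q in 𝓝[>] (0 : ℝ) ×ˢ 𝓝 p,
      ‖(A.symm : Plane →L[ℝ] Plane)‖ * q.1 + dist (e q.2) (e p) < s := by
    have hfst : Tendsto Prod.fst (𝓝[>] (0 : ℝ) ×ˢ 𝓝 p) (𝓝 0) :=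
      tendsto_fst.mono_right nhdsWithin_le_nhds
    have := (hfst.const_mul ‖(A.symm : Plane →L[ℝ] Plane)‖).add
      (tendsto_iff_dist_tendsto_zero.1 ((e.continuousAt hp).tendsto.comp tendsto_snd))
    exact this.eventually_lt_const (by simpa using hs)
  filter_upwards [hsmall, tendsto_fst.eventually self_mem_nhdsWithin,
    tendsto_snd.eventually (e.open_source.mem_nhds hp)] with q hq hq0 hqe
  refine (ENNReal.ofReal_le_ofReal (by gcongr)).trans (hflat.le_riemVolume_ball he hε.le hε1.le
    (convex_ball _ _) hqe hq0 fun z hz ↦ ?_)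
  have hbound : ‖z - e q.2‖ ≤ ‖(A.symm : Plane →L[ℝ] Plane)‖ * q.1 := by
    simpa using (A.symm : Plane →L[ℝ] Plane).le_opNorm_of_le
      (hz.le.trans (div_le_self hq0.le (by linarith)))
  rw [Metric.mem_ball]
  linarith [dist_triangle z (e q.2) (e p), dist_eq_norm z (e q.2)]

variable [CompactSpace M]

theorem exists_upperRegular {κ : ℝ} (hκ : Real.pi < κ) :
    ∃ R > 0, UpperRegular (riemVolume M) κ R :=
  exists_forall_of_eventually_nhdsGT_prod_nhds fun p ↦ eventually_riemVolume_ball_le p hκ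

theorem exists_lowerRegular {κ : ℝ} (hκ : κ < Real.pi) :
    ∃ R > 0, LowerRegular (riemVolume M) κ R :=
  exists_forall_of_eventually_nhdsGT_prod_nhds fun p ↦ eventually_le_riemVolume_ball p hκ

end SmallBalls

/-! ### Locally Lipschitz functions on open sets -/

section LocallyLipschitz

variable {E : Type*} [NormedAddCommGroup E] [NormedSpace ℝ E] [MeasurableSpace E]
  [BorelSpace E] {μ : Measure E} {f g : E → ℝ} {U : Set E}

theorem locallyIntegrableOn_fderiv_of_locallyLipschitzOn [IsLocallyFiniteMeasure μ]
    (hU : IsOpen U) (hf : LocallyLipschitzOn U f) (v : E) :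
    LocallyIntegrableOn (fun z ↦ fderiv ℝ f z v) U μ := by
  intro z hz
  obtain ⟨C, t, ht, hC⟩ := hf hz
  rw [hU.nhdsWithin_eq hz] at ht ⊢
  refine (μ.finiteAt_nhds z).integrableAtFilter
    (measurable_fderiv_apply_const ℝ f v).stronglyMeasurable.stronglyMeasurableAtFilter
    (isBoundedUnder_of_eventually_le (a := C * ‖v‖) ?_)
  filter_upwards [eventually_mem_nhds_iff.2 ht] with w hw
  exact (fderiv ℝ f w).le_of_opNorm_le (norm_fderiv_le_of_lipschitzOn ℝ hw hC) v

variable [FiniteDimensional ℝ E]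

theorem ae_differentiableAt_of_locallyLipschitzOn [μ.IsAddHaarMeasure] (hU : IsOpen U)
    (hf : LocallyLipschitzOn U f) : ∀ᵐ z ∂μ.restrict U, DifferentiableAt ℝ f z := by
  rw [ae_restrict_iff' hU.measurableSet, ae_iff]
  refine measure_null_of_locally_null _ fun z hz ↦ ?_
  obtain ⟨C, t, ht, hC⟩ := hf (Classical.not_imp.1 hz).1
  rw [hU.nhdsWithin_eq (Classical.not_imp.1 hz).1] at ht
  refine ⟨interior t ∩ {w | ¬(w ∈ U → DifferentiableAt ℝ f w)},
    inter_mem (mem_nhdsWithin_of_mem_nhds (interior_mem_nhds.2 ht)) self_mem_nhdsWithin, ?_⟩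
  refine measure_mono_null ?_ (ae_iff.1 hC.ae_differentiableWithinAt_of_mem)
  rintro w ⟨hwt, hw⟩ hcon
  exact hw fun _ ↦ (hcon (interior_subset hwt)).differentiableAt (mem_interior_iff_mem_nhds.1 hwt)

theorem setIntegral_mul_fderiv_eq_neg [μ.IsAddHaarMeasure] (hU : IsOpen U)
    (hf : LocallyLipschitzOn U f) {η : E → ℝ} (hη : ContDiff ℝ 1 η) (hsupp : HasCompactSupport η)
    (hsub : tsupport η ⊆ U) (v : E) :
    ∫ z in U, f z * fderiv ℝ η z v ∂μ = -∫ z in U, fderiv ℝ f z v * η z ∂μ := by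
  obtain ⟨S, hS, hηS, hSU⟩ := exists_compact_between hsupp hU hsub
  obtain ⟨C, hC⟩ := (hf.mono hSU).exists_lipschitzOnWith_of_compact hS
  obtain ⟨F, hF, hFf⟩ := hC.extend_real
  obtain ⟨D, hD⟩ := hη.lipschitzWith_of_hasCompactSupport hsupp one_ne_zero
  have hleft : ∫ z in U, f z * fderiv ℝ η z v ∂μ = ∫ z, F z * fderiv ℝ η z v ∂μ := by
    rw [setIntegral_eq_integral_of_forall_compl_eq_zero fun z hz ↦ by
      simp [fderiv_of_notMem_tsupport ℝ fun h ↦ hz (hsub h)]]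
    refine integral_congr_ae (Eventually.of_forall fun z ↦ ?_)
    by_cases hz : z ∈ tsupport η
    · simp only [hFf (interior_subset (hηS hz))]
    · simp [fderiv_of_notMem_tsupport ℝ hz]
  have hright : ∫ z in U, fderiv ℝ f z v * η z ∂μ = ∫ z, lineDeriv ℝ F z v * η z ∂μ := by
    rw [← setIntegral_eq_integral_of_forall_compl_eq_zero (s := U) (μ := μ)
      (f := fun z ↦ lineDeriv ℝ F z v * η z) fun z hz ↦ by
        simp [image_eq_zero_of_notMem_tsupport fun h ↦ hz (hsub h)]]
    refine integral_congr_ae ?_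
    filter_upwards [ae_differentiableAt_of_locallyLipschitzOn hU hf] with z hz
    by_cases hzη : z ∈ tsupport η
    · have hFf' : F =ᶠ[𝓝 z] f := by
        filter_upwards [isOpen_interior.mem_nhds (hηS hzη)] with w hw
        exact (hFf (interior_subset hw)).symm
      rw [hFf'.lineDeriv_eq, hz.lineDeriv_eq_fderiv]
    · simp [image_eq_zero_of_notMem_tsupport hzη]
  rw [hleft, hright, hF.integral_lineDeriv_mul_eq hD hsupp v, ← integral_neg]
  refine integral_congr_ae (Eventually.of_forall fun z ↦ ?_)
  simp only [(hη.differentiable one_ne_zero z).lineDeriv_eq_fderiv, map_neg]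
  ring

theorem ae_eq_of_forall_setIntegral_mul_eq (hU : IsOpen U)
    (hf : LocallyIntegrableOn f U μ) (hg : LocallyIntegrableOn g U μ)
    (h : ∀ η : E → ℝ, ContDiff ℝ ∞ η → HasCompactSupport η → tsupport η ⊆ U →
      ∫ z in U, f z * η z ∂μ = ∫ z in U, g z * η z ∂μ) :
    ∀ᵐ z ∂μ.restrict U, f z = g z := by
  rw [ae_restrict_iff' hU.measurableSet]
  have hzero : ∀ᵐ z ∂μ, z ∈ U → (f - g) z = 0 := by
    refine hU.ae_eq_zero_of_integral_contDiff_smul_eq_zero (hf.sub hg) fun η hη hsupp hsub ↦ ?_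
    have hint (k : E → ℝ) (hk : LocallyIntegrableOn k U μ) :
        IntegrableOn (fun z ↦ k z * η z) U μ :=
      (((hk.integrableOn_compact_subset hsub hsupp).mul_continuousOn
        hη.continuous.continuousOn hsupp).of_forall_sdiff_eq_zero hU.measurableSet fun z hz ↦ by
          simp [image_eq_zero_of_notMem_tsupport hz.2])
    rw [← setIntegral_eq_integral_of_forall_compl_eq_zero (s := U) fun z hz ↦ by
      simp [image_eq_zero_of_notMem_tsupport fun h ↦ hz (hsub h)]]
    simp only [smul_eq_mul, mul_comm (η _), Pi.sub_apply, sub_mul]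
    rw [integral_sub (hint f hf) (hint g hg), h η hη hsupp hsub, sub_self]
  filter_upwards [hzero] with z hz hzU
  exact sub_eq_zero.1 (hz hzU)

end LocallyLipschitz

/-! ### The gradient of a Lipschitz function -/

section Gradient

variable {M : Type*} [MetricSpace M] [ChartedSpace Plane M]
  {e : OpenPartialHomeomorph M Plane} {u w : M → ℝ} {z : Plane}

theorem mdifferentiableAt_symm_apply_iff [IsManifold (𝓡 2) 1 M] (he : e ∈ atlas Plane M)
    (hz : z ∈ e.target) :
    MDifferentiableAt (𝓡 2) 𝓘(ℝ, ℝ) u (e.symm z) ↔ DifferentiableAt ℝ (u ∘ e.symm) z := by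
  have hmd := mdifferentiable_of_mem_atlas (I := 𝓡 2) he
  refine ⟨fun h ↦ (h.comp z (hmd.mdifferentiableAt_symm hz)).differentiableAt, fun h ↦ ?_⟩
  have hzs := e.map_target hz
  have hcomp : MDifferentiableAt (𝓡 2) 𝓘(ℝ, ℝ) ((u ∘ e.symm) ∘ e) (e.symm z) :=
    MDifferentiableAt.comp _ (by rw [e.right_inv hz]; exact h.mdifferentiableAt)
      (hmd.mdifferentiableAt hzs)
  refine hcomp.congr_of_eventuallyEq ?_
  filter_upwards [e.open_source.mem_nhds hzs] with x hx
  simp only [Function.comp_apply, e.left_inv hx]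

instance (x : M) : FiniteDimensional ℝ (TangentSpace (𝓡 2) x) :=
  inferInstanceAs (FiniteDimensional ℝ Plane)

variable [RiemannianBundle (fun x : M ↦ TangentSpace (𝓡 2) x)]

/-- The classical gradient: the vector field dual to the differential of `u`. It vanishes at the
points where `u` is not differentiable. -/
def riemGrad (u : M → ℝ) (x : M) : TangentSpace (𝓡 2) x :=
  have : CompleteSpace (TangentSpace (𝓡 2) x) := FiniteDimensional.complete ℝ _
  (InnerProductSpace.toDual ℝ (TangentSpace (𝓡 2) x)).symm (mfderiv (𝓡 2) 𝓘(ℝ, ℝ) u x)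

theorem inner_riemGrad (u : M → ℝ) (x : M) (v : TangentSpace (𝓡 2) x) :
    inner ℝ (riemGrad u x) v = mfderiv (𝓡 2) 𝓘(ℝ, ℝ) u x v :=
  have : CompleteSpace (TangentSpace (𝓡 2) x) := FiniteDimensional.complete ℝ _
  InnerProductSpace.toDual_symm_apply

theorem riemGrad_sub_const_mul {x : M} (hu : MDifferentiableAt (𝓡 2) 𝓘(ℝ, ℝ) u x)
    (hw : MDifferentiableAt (𝓡 2) 𝓘(ℝ, ℝ) w x) (c : ℝ) :
    riemGrad (fun y ↦ u y - c * w y) x = riemGrad u x - c • riemGrad w x := by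
  refine ext_inner_right ℝ fun v ↦ ?_
  rw [inner_sub_left, real_inner_smul_left, inner_riemGrad, inner_riemGrad, inner_riemGrad]
  have h := (hu.hasMFDerivAt.sub (hw.hasMFDerivAt.const_smul c)).mfderiv
  exact congrArg (fun f : Plane →L[ℝ] ℝ ↦ f v) h

variable [IsManifold (𝓡 2) 1 M]

theorem inner_riemGrad_coordVec (he : e ∈ atlas Plane M) (hz : z ∈ e.target) (v : Plane) :
    inner ℝ (riemGrad u (e.symm z)) (coordVec e z v) = fderiv ℝ (u ∘ e.symm) z v := by
  rw [inner_riemGrad]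
  by_cases h : MDifferentiableAt (𝓡 2) 𝓘(ℝ, ℝ) u (e.symm z)
  · have hchain := mfderiv_comp z h
      ((mdifferentiable_of_mem_atlas (I := 𝓡 2) he).mdifferentiableAt_symm hz)
    rw [mfderiv_eq_fderiv] at hchain
    exact (congrArg (fun f : Plane →L[ℝ] ℝ ↦ f v) hchain).symm
  · rw [mfderiv_zero_of_not_mdifferentiableAt h,
      fderiv_zero_of_not_differentiableAt (mt (mdifferentiableAt_symm_apply_iff he hz).2 h)]
    rfl

theorem norm_sq_mul_gram_det (he : e ∈ atlas Plane M) (hz : z ∈ e.target)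
    (G : TangentSpace (𝓡 2) (e.symm z)) :
    ‖G‖ ^ 2 * (gram e z).det =
      gram e z 1 1 * inner ℝ G (coordVec e z (EuclideanSpace.single 0 1)) ^ 2
        - 2 * gram e z 0 1 * inner ℝ G (coordVec e z (EuclideanSpace.single 0 1)) *
          inner ℝ G (coordVec e z (EuclideanSpace.single 1 1))
        + gram e z 0 0 * inner ℝ G (coordVec e z (EuclideanSpace.single 1 1)) ^ 2 := by
  obtain ⟨v, rfl⟩ := (coordEquiv he hz).surjective G
  have hv : v = v 0 • EuclideanSpace.single 0 1 + v 1 • EuclideanSpace.single 1 1 := by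
    ext i
    fin_cases i <;> simp
  have hsymm : gram e z 1 0 = gram e z 0 1 := real_inner_comm
    (coordVec e z (EuclideanSpace.single 0 1)) (coordVec e z (EuclideanSpace.single 1 1))
  have hinner (i : Fin 2) :
      inner ℝ (coordEquiv he hz v) (coordVec e z (EuclideanSpace.single i 1)) =
        v 0 * gram e z 0 i + v 1 * gram e z 1 i := by
    conv_lhs => rw [coordEquiv_apply, hv]
    simp only [coordVec_add, coordVec_smul, inner_add_left, real_inner_smul_left]
    rfl
  have hnorm : ‖coordEquiv he hz v‖ ^ 2 =
      v 0 * inner ℝ (coordEquiv he hz v) (coordVec e z (EuclideanSpace.single 0 1)) +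
        v 1 * inner ℝ (coordEquiv he hz v) (coordVec e z (EuclideanSpace.single 1 1)) := by
    rw [← real_inner_self_eq_norm_sq, ← real_inner_smul_right, ← real_inner_smul_right,
      ← inner_add_right, ← coordVec_smul, ← coordVec_smul, ← coordVec_add, ← hv,
      coordEquiv_apply]
  rw [hnorm, hinner, hinner, Matrix.det_fin_two, hsymm]
  ring

variable [IsContinuousRiemannianBundle Plane (fun x : M ↦ TangentSpace (𝓡 2) x)]
  [IsRiemannianManifold (𝓡 2) M]

theorem eventually_dist_symm_le (he : e ∈ atlas Plane M) (hz : z ∈ e.target) {v : Plane} {C : ℝ}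
    (hC : ‖coordVec e z v‖ < C) :
    ∀ᶠ t : ℝ in 𝓝 0, dist (e.symm (z + t • v)) (e.symm z) ≤ C * |t| := by
  have hnear : ∀ᶠ p in 𝓝 z, p ∈ e.target ∧ ‖coordVec e p v‖ < C :=
    (e.open_target.eventually_mem hz).and
      ((((continuousOn_norm_coordVec he).comp (Continuous.prodMk_left v).continuousOn
        fun p hp ↦ ⟨hp, mem_univ v⟩).continuousAt
          (e.open_target.mem_nhds hz)).eventually_lt_const hC)
  obtain ⟨s, hs, hball⟩ := Metric.eventually_nhds_iff_ball.1 hnear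
  have hline : Tendsto (fun t : ℝ ↦ z + t • v) (𝓝 0) (𝓝 z) :=
    (by fun_prop : Continuous fun t : ℝ ↦ z + t • v).tendsto' 0 z (by simp)
  filter_upwards [hline.eventually_mem (Metric.ball_mem_nhds z hs)] with t ht
  have hseg := (convex_ball z s).segment_subset (Metric.mem_ball_self hs) ht
  rw [dist_comm]
  refine dist_symm_le he (mul_nonneg ((norm_nonneg _).trans hC.le) (abs_nonneg t))
    (fun p hp ↦ (hball p (hseg hp)).1) fun p hp ↦ ?_
  rw [add_sub_cancel_left, coordVec_smul, norm_smul, Real.norm_eq_abs, mul_comm]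
  gcongr
  exact (hball p (hseg hp)).2.le

theorem norm_riemGrad_le {x : M} {L : ℝ} (hL : 0 ≤ L)
    (h : ∀ L' > L, ∀ᶠ y in 𝓝 x, |u y - u x| ≤ L' * dist y x) : ‖riemGrad u x‖ ≤ L := by
  obtain ⟨e, he, z, hz, rfl⟩ : ∃ e ∈ atlas Plane M, ∃ z ∈ e.target, e.symm z = x :=
    ⟨chartAt Plane x, chart_mem_atlas Plane x, chartAt Plane x x, mem_chart_target Plane x,
      (chartAt Plane x).left_inv (mem_chart_source Plane x)⟩
  obtain ⟨v, hv⟩ := (coordEquiv he hz).surjective (riemGrad u (e.symm z))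
  rw [coordEquiv_apply] at hv
  have hderiv : |fderiv ℝ (u ∘ e.symm) z v| ≤ L * ‖coordVec e z v‖ := by
    by_cases hd : DifferentiableAt ℝ (u ∘ e.symm) z
    swap
    · rw [fderiv_zero_of_not_differentiableAt hd]
      simpa using mul_nonneg hL (norm_nonneg _)
    refine le_mul_of_forall_lt₀ fun L' hL' C hC ↦ ?_
    have hpos : 0 ≤ L' := hL.trans hL'.le
    have hdir : HasDerivAt (fun t : ℝ ↦ (u ∘ e.symm) (z + t • v))
        (fderiv ℝ (u ∘ e.symm) z v) 0 :=
      hd.hasFDerivAt.hasLineDerivAt v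
    refine hdir.le_of_lip' (mul_nonneg hpos ((norm_nonneg _).trans hC.le)) ?_
    have hline : Tendsto (fun t : ℝ ↦ e.symm (z + t • v)) (𝓝 0) (𝓝 (e.symm z)) :=
      (e.continuousAt_symm hz).tendsto.comp
        ((by fun_prop : Continuous fun t : ℝ ↦ z + t • v).tendsto' 0 z (by simp))
    filter_upwards [eventually_dist_symm_le he hz hC, hline.eventually (h L' hL')] with t ht ht'
    simp only [Function.comp_apply, zero_smul, add_zero, sub_zero, Real.norm_eq_abs, mul_assoc]
    exact ht'.trans (by gcongr)
  rw [← inner_riemGrad_coordVec he hz, hv, real_inner_self_eq_norm_sq,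
    abs_of_nonneg (sq_nonneg _), sq] at hderiv
  by_contra! hlt
  exact hderiv.not_gt (mul_lt_mul_of_pos_right hlt (hL.trans_lt hlt))

theorem norm_riemGrad_le_of_lipschitzWith {K : NNReal} (hu : LipschitzWith K u) (x : M) :
    ‖riemGrad u x‖ ≤ K :=
  norm_riemGrad_le K.2 fun L' hL' ↦ Eventually.of_forall fun y ↦
    (hu.dist_le_mul y x).trans (by gcongr)

theorem locallyLipschitzOn_symm (he : e ∈ atlas Plane M) :
    LocallyLipschitzOn e.target e.symm := by
  intro z hz
  obtain ⟨A, s, hs, hflat⟩ := exists_almostFlat he hz one_pos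
  refine ⟨2 * ‖(A : Plane →L[ℝ] Plane)‖₊, Metric.ball z s,
    mem_nhdsWithin_of_mem_nhds (Metric.ball_mem_nhds z hs),
    LipschitzOnWith.of_dist_le_mul fun p hp q hq ↦ ?_⟩
  have hseg := (convex_ball z s).segment_subset hp hq
  refine dist_symm_le he (by positivity) (hseg.trans hflat.subset_target) fun y hy ↦ ?_
  calc ‖coordVec e y (q - p)‖ ≤ (1 + 1) * ‖A (q - p)‖ := hflat.norm_le y (hseg hy) _
    _ ≤ (1 + 1) * (‖(A : Plane →L[ℝ] Plane)‖ * ‖q - p‖) := by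
      gcongr
      exact (A : Plane →L[ℝ] Plane).le_opNorm _
    _ = (2 * ‖(A : Plane →L[ℝ] Plane)‖₊ : NNReal) * dist p q := by
      rw [dist_comm, dist_eq_norm]
      push_cast
      ring

theorem locallyLipschitzOn_comp_symm (hu : LocallyLipschitz u) (he : e ∈ atlas Plane M) :
    LocallyLipschitzOn e.target (u ∘ e.symm) := by
  intro z hz
  obtain ⟨C, s, hs, hC⟩ := locallyLipschitzOn_symm he hz
  obtain ⟨K, t, ht, hK⟩ := hu (e.symm z)
  exact ⟨K * C, s ∩ e.symm ⁻¹' t,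
    inter_mem hs (mem_nhdsWithin_of_mem_nhds ((e.continuousAt_symm hz).preimage_mem_nhds ht)),
    hK.comp (hC.mono inter_subset_left) fun y hy ↦ hy.2⟩

theorem isWeakGradient_riemGrad (hu : LocallyLipschitz u) : IsWeakGradient u (riemGrad u) := by
  intro e he
  have hloc := locallyLipschitzOn_comp_symm hu he
  refine ⟨hloc.continuousOn.locallyIntegrableOn e.open_target.measurableSet,
    fun v ↦ ⟨?_, fun η hη hsupp hsub ↦ ?_⟩⟩
  · refine (locallyIntegrableOn_fderiv_of_locallyLipschitzOn e.open_target hloc v).congr ?_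
    exact (ae_restrict_mem e.open_target.measurableSet).mono fun z hz ↦
      (inner_riemGrad_coordVec he hz v).symm
  · rw [setIntegral_congr_fun e.open_target.measurableSet fun z hz ↦
      congrArg (· * η z) (inner_riemGrad_coordVec he hz v)]
    exact setIntegral_mul_fderiv_eq_neg e.open_target hloc (hη.of_le (by simp)) hsupp hsub v

end Gradient

/-! ### Weak gradients -/

section WeakGradient

theorem exists_countable_iUnion_source {M : Type*} [TopologicalSpace M] [LindelofSpace M]
    [ChartedSpace Plane M] :
    ∃ s : Set M, s.Countable ∧ ⋃ x : s, (chartAt Plane (x : M)).source = univ := by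
  obtain ⟨s, hs, hcover⟩ := countable_cover_nhds fun x : M ↦
    (chartAt Plane x).open_source.mem_nhds (mem_chart_source Plane x)
  exact ⟨s, hs, by rwa [biUnion_eq_iUnion] at hcover⟩

variable {M : Type*} [MetricSpace M] [ChartedSpace Plane M]
  [RiemannianBundle (fun x : M ↦ TangentSpace (𝓡 2) x)]

section ChartVolume

variable [MeasurableSpace M] [BorelSpace M] {e : OpenPartialHomeomorph M Plane}

theorem aemeasurable_chartVolume (e : OpenPartialHomeomorph M Plane) :
    AEMeasurable e (chartVolume e) := by
  rw [← chartVolume_restrict_source]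
  exact e.continuousOn.aemeasurable e.open_source.measurableSet

theorem ae_mem_source (e : OpenPartialHomeomorph M Plane) : ∀ᵐ x ∂chartVolume e, x ∈ e.source := by
  rw [← chartVolume_restrict_source]
  exact ae_restrict_mem e.open_source.measurableSet

theorem map_chartVolume_absolutelyContinuous (e : OpenPartialHomeomorph M Plane) :
    (chartVolume e).map e ≪ volume.restrict e.target := by
  let ν := (volume.restrict e.target).withDensity fun z ↦ ENNReal.ofReal (√(gram e z).det)
  have hν : ν ≪ volume.restrict e.target := withDensity_absolutelyContinuous _ _
  have hmap : (chartVolume e).map e = ν := by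
    rw [chartVolume, AEMeasurable.map_map_of_aemeasurable (aemeasurable_chartVolume e)
      ((e.continuousOn_symm.aemeasurable e.open_target.measurableSet).mono_ac hν)]
    refine (Measure.map_congr (g := id) ?_).trans Measure.map_id
    filter_upwards [hν.ae_le (ae_restrict_mem e.open_target.measurableSet)] with z hz
    exact e.right_inv hz
  rwa [hmap]

theorem ae_chartVolume {P : M → Prop} (h : ∀ᵐ z ∂volume.restrict e.target, P (e.symm z)) :
    ∀ᵐ x ∂chartVolume e, P x := by
  filter_upwards [ae_of_ae_map (aemeasurable_chartVolume e)
    ((map_chartVolume_absolutelyContinuous e).ae_le h), ae_mem_source e] with x hx hxs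
  rwa [e.left_inv hxs] at hx

theorem aemeasurable_of_comp_symm {F : M → ℝ}
    (h : AEMeasurable (F ∘ e.symm) (volume.restrict e.target)) :
    AEMeasurable F (chartVolume e) := by
  refine ((h.mono_ac (map_chartVolume_absolutelyContinuous e)).comp_aemeasurable
    (aemeasurable_chartVolume e)).congr ?_
  filter_upwards [ae_mem_source e] with x hx
  simp only [Function.comp_apply, e.left_inv hx]

end ChartVolume

variable [IsManifold (𝓡 2) 1 M]

theorem IsWeakGradient.ae_eq_comp_symm {u : M → ℝ} {G G' : ∀ x : M, TangentSpace (𝓡 2) x}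
    (h : IsWeakGradient u G) (h' : IsWeakGradient u G') {e : OpenPartialHomeomorph M Plane}
    (he : e ∈ atlas Plane M) :
    ∀ᵐ z ∂volume.restrict e.target, G (e.symm z) = G' (e.symm z) := by
  have hcoord (v : Plane) : ∀ᵐ z ∂volume.restrict e.target,
      inner ℝ (G (e.symm z)) (coordVec e z v) = inner ℝ (G' (e.symm z)) (coordVec e z v) := by
    obtain ⟨hint, hG⟩ := (h e he).2 v
    obtain ⟨hint', hG'⟩ := (h' e he).2 v
    exact ae_eq_of_forall_setIntegral_mul_eq e.open_target hint hint' fun η hη hsupp hsub ↦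
      neg_injective ((hG η hη hsupp hsub).symm.trans (hG' η hη hsupp hsub))
  filter_upwards [ae_all_iff.2 fun i : Fin 2 ↦ hcoord (EuclideanSpace.single i 1),
    ae_restrict_mem e.open_target.measurableSet] with z hbasis hz
  let b := (EuclideanSpace.basisFun (Fin 2) ℝ).toBasis.map (coordEquiv he hz).toLinearEquiv
  refine InnerProductSpace.ext_inner_right_basis b fun i ↦ ?_
  simpa [b, coordEquiv_apply] using hbasis i

variable [MeasurableSpace M] [BorelSpace M] [LindelofSpace M]

theorem ae_riemVolume_of_forall_chart {P : M → Prop}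
    (h : ∀ e ∈ atlas Plane M, ∀ᵐ z ∂volume.restrict e.target, P (e.symm z)) :
    ∀ᵐ x ∂riemVolume M, P x := by
  obtain ⟨s, hs, hcover⟩ := exists_countable_iUnion_source (M := M)
  have := hs.to_subtype
  rw [← Measure.restrict_univ (μ := riemVolume M), ← hcover, ae_restrict_iUnion_iff]
  intro x
  rw [riemVolume_restrict_source (chart_mem_atlas Plane (x : M))]
  exact ae_chartVolume (h _ (chart_mem_atlas Plane (x : M)))

theorem aemeasurable_riemVolume_of_forall_chart {F : M → ℝ}
    (h : ∀ e ∈ atlas Plane M, AEMeasurable (F ∘ e.symm) (volume.restrict e.target)) :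
    AEMeasurable F (riemVolume M) := by
  obtain ⟨s, hs, hcover⟩ := exists_countable_iUnion_source (M := M)
  have := hs.to_subtype
  rw [← Measure.restrict_univ (μ := riemVolume M), ← hcover, aemeasurable_iUnion_iff]
  intro x
  rw [riemVolume_restrict_source (chart_mem_atlas Plane (x : M))]
  exact aemeasurable_of_comp_symm (h _ (chart_mem_atlas Plane (x : M)))

variable [IsContinuousRiemannianBundle Plane (fun x : M ↦ TangentSpace (𝓡 2) x)] {u : M → ℝ}

theorem aemeasurable_norm_riemGrad (u : M → ℝ) :
    AEMeasurable (fun x ↦ ‖riemGrad u x‖) (riemVolume M) := by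
  refine aemeasurable_riemVolume_of_forall_chart fun e he ↦ ?_
  have hmeas := e.open_target.measurableSet
  have hgram (i j : Fin 2) : AEMeasurable (fun z ↦ gram e z i j) (volume.restrict e.target) :=
    (continuousOn_inner_coordVec he _ _).aemeasurable hmeas
  have hdet : AEMeasurable (fun z ↦ (gram e z).det) (volume.restrict e.target) := by
    simp only [Matrix.det_fin_two]
    fun_prop
  have hpartial (v : Plane) :
      AEMeasurable (fun z ↦ fderiv ℝ (u ∘ e.symm) z v) (volume.restrict e.target) :=
    (measurable_fderiv_apply_const ℝ _ v).aemeasurable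
  have hmain : AEMeasurable (fun z ↦ √((gram e z 1 1 *
      fderiv ℝ (u ∘ e.symm) z (EuclideanSpace.single 0 1) ^ 2 -
      2 * gram e z 0 1 * fderiv ℝ (u ∘ e.symm) z (EuclideanSpace.single 0 1) *
        fderiv ℝ (u ∘ e.symm) z (EuclideanSpace.single 1 1) +
      gram e z 0 0 * fderiv ℝ (u ∘ e.symm) z (EuclideanSpace.single 1 1) ^ 2) /
        (gram e z).det)) (volume.restrict e.target) := by
    fun_prop
  refine hmain.congr ?_
  filter_upwards [ae_restrict_mem hmeas] with z hz
  simp only [← inner_riemGrad_coordVec he hz, ← norm_sq_mul_gram_det he hz,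
    mul_div_cancel_right₀ _ (gram_det_pos he hz).ne', Real.sqrt_sq (norm_nonneg _),
    Function.comp_apply]

variable [IsRiemannianManifold (𝓡 2) M]

theorem ae_mdifferentiableAt (hu : LocallyLipschitz u) :
    ∀ᵐ x ∂riemVolume M, MDifferentiableAt (𝓡 2) 𝓘(ℝ, ℝ) u x :=
  ae_riemVolume_of_forall_chart fun e he ↦ by
    filter_upwards [ae_differentiableAt_of_locallyLipschitzOn e.open_target
      (locallyLipschitzOn_comp_symm hu he), ae_restrict_mem e.open_target.measurableSet]
      with z hz hzt using (mdifferentiableAt_symm_apply_iff he hzt).2 hz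

variable [IsFiniteMeasure (riemVolume M)] {K : NNReal}

theorem hasL2Gradient_riemGrad (hu : LipschitzWith K u) : HasL2Gradient u (riemGrad u) :=
  ⟨isWeakGradient_riemGrad hu.locallyLipschitz,
    MemLp.of_bound (aemeasurable_norm_riemGrad u).aestronglyMeasurable K
      (Eventually.of_forall fun x ↦ by
        simpa using norm_riemGrad_le_of_lipschitzWith hu x)⟩

theorem ae_grad_eq_riemGrad (hu : LipschitzWith K u) :
    ∀ᵐ x ∂riemVolume M, grad u x = riemGrad u x := by
  have hex : ∃ G, HasL2Gradient u G := ⟨_, hasL2Gradient_riemGrad hu⟩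
  rw [show grad u = hex.choose from dif_pos hex]
  exact ae_riemVolume_of_forall_chart fun e he ↦
    hex.choose_spec.1.ae_eq_comp_symm (isWeakGradient_riemGrad hu.locallyLipschitz) he

theorem memH1_of_lipschitzWith [CompactSpace M] (hu : LipschitzWith K u) : MemH1 u :=
  ⟨hu.continuous.memLp_of_hasCompactSupport (HasCompactSupport.of_compactSpace u), _,
    hasL2Gradient_riemGrad hu⟩

end WeakGradient

/-! ### Integrals of functions of the distance -/

section Growth

theorem integrable_and_integral_le_of_measure_lt_le {α : Type*} [MeasurableSpace α]
    {μ : Measure α} [IsProbabilityMeasure μ] {f : α → ℝ} (hf : AEMeasurable f μ) (hf0 : 0 ≤ f)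
    {a : ℝ} (ha : 0 ≤ a) {g : ℝ → ℝ} (hg : IntegrableOn g (Ioi a)) (hg0 : ∀ s > a, 0 ≤ g s)
    (h : ∀ s > a, μ {y | s < f y} ≤ ENNReal.ofReal (g s)) :
    Integrable f μ ∧ ∫ y, f y ∂μ ≤ a + ∫ s in Ioi a, g s := by
  have hint : 0 ≤ ∫ s in Ioi a, g s := setIntegral_nonneg measurableSet_Ioi hg0
  have htail : ∫⁻ s in Ioi a, μ {y | s < f y} ≤ ENNReal.ofReal (∫ s in Ioi a, g s) := by
    rw [ofReal_integral_eq_lintegral_ofReal hg (ae_restrict_of_forall_mem measurableSet_Ioi hg0)]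
    exact setLIntegral_mono' measurableSet_Ioi h
  have hkey : ∫⁻ y, ENNReal.ofReal (f y) ∂μ ≤ ENNReal.ofReal (a + ∫ s in Ioi a, g s) := by
    rw [lintegral_eq_lintegral_meas_lt μ (Eventually.of_forall hf0) hf,
      ← Ioc_union_Ioi_eq_Ioi ha, lintegral_union measurableSet_Ioi (Ioc_disjoint_Ioi le_rfl),
      ENNReal.ofReal_add ha hint]
    refine add_le_add ?_ htail
    calc ∫⁻ s in Ioc 0 a, μ {y | s < f y} ≤ ∫⁻ _ in Ioc 0 a, 1 :=
          lintegral_mono fun s ↦ prob_le_one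
      _ = ENNReal.ofReal a := by simp
  refine ⟨⟨hf.aestronglyMeasurable, ?_⟩, ?_⟩
  · rw [hasFiniteIntegral_iff_ofReal (Eventually.of_forall hf0)]
    exact hkey.trans_lt ENNReal.ofReal_lt_top
  · rw [integral_eq_lintegral_of_nonneg_ae (Eventually.of_forall hf0) hf.aestronglyMeasurable]
    exact ENNReal.toReal_le_of_le_ofReal (by positivity) hkey

variable {M : Type*} [MetricSpace M] [MeasurableSpace M] {μ : Measure M} {κ R : ℝ}

theorem UpperRegular.measure_singleton (hR : 0 < R) (h : UpperRegular μ κ R) (x : M) :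
    μ {x} = 0 := by
  have hlim : Tendsto (fun r : ℝ ↦ ENNReal.ofReal (κ * r ^ 2)) (𝓝[>] 0) (𝓝 0) :=
    ((ENNReal.continuous_ofReal.comp (by fun_prop)).tendsto' 0 0 (by simp)).mono_left
      nhdsWithin_le_nhds
  refine le_antisymm (ge_of_tendsto hlim ?_) zero_le
  filter_upwards [Ioo_mem_nhdsGT hR] with r hr
  exact (measure_mono (singleton_subset_iff.2 (Metric.mem_ball_self hr.1))).trans
    (h x r hr.1 hr.2.le)

variable [BorelSpace M] [IsProbabilityMeasure μ]

theorem UpperRegular.exists_half_le_measureReal_compl_ball (hR : 0 < R)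
    (h : UpperRegular μ κ R) :
    ∃ r ∈ Ioc (0 : ℝ) 1, ∀ x : M, 1 / 2 ≤ μ.real (Metric.ball x r)ᶜ := by
  have hlim : Tendsto (fun r : ℝ ↦ κ * r ^ 2) (𝓝[>] 0) (𝓝 0) :=
    ((by fun_prop : Continuous fun r : ℝ ↦ κ * r ^ 2).tendsto' 0 0 (by simp)).mono_left
      nhdsWithin_le_nhds
  obtain ⟨r, hκr, hr⟩ := ((hlim.eventually_le_const one_half_pos).and
    (Ioc_mem_nhdsGT (lt_min hR one_pos))).exists
  refine ⟨r, ⟨hr.1, hr.2.trans (min_le_right _ _)⟩, fun x ↦ ?_⟩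
  have hball : μ.real (Metric.ball x r) ≤ 1 / 2 :=
    ENNReal.toReal_le_of_le_ofReal (by norm_num)
      ((h x r hr.1 (hr.2.trans (min_le_left _ _))).trans (ENNReal.ofReal_le_ofReal hκr))
  rw [probReal_compl_eq_one_sub Metric.isOpen_ball.measurableSet]
  linarith

theorem UpperRegular.integrable_and_integral_inv_dist_le (hκ : 0 ≤ κ) (hR : 0 < R)
    (h : UpperRegular μ κ R) (x : M) :
    Integrable (fun y ↦ (dist x y)⁻¹) μ ∧ ∫ y, (dist x y)⁻¹ ∂μ ≤ R⁻¹ + κ * R := by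
  have hRinv : 0 < R⁻¹ := inv_pos.2 hR
  have htail : ∫ s in Ioi R⁻¹, κ * s ^ (-2 : ℝ) = κ * R := by
    rw [integral_const_mul, integral_Ioi_rpow_of_lt (by norm_num) hRinv]
    norm_num [Real.rpow_neg_one]
  rw [← htail]
  refine integrable_and_integral_le_of_measure_lt_le
    (continuous_const.dist continuous_id).measurable.inv.aemeasurable
    (fun y ↦ inv_nonneg.2 dist_nonneg) hRinv.le
    ((integrableOn_Ioi_rpow_of_lt (by norm_num) hRinv).const_mul κ)
    (fun s hs ↦ mul_nonneg hκ (Real.rpow_nonneg (hRinv.trans hs).le _)) fun s hs ↦ ?_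
  have hs0 : 0 < s := hRinv.trans hs
  have hsub : {y | s < (dist x y)⁻¹} ⊆ Metric.ball x s⁻¹ := fun y hy ↦
    Metric.mem_ball'.2 ((lt_inv_comm₀ hs0 (inv_pos.1 (hs0.trans hy))).1 hy)
  refine (measure_mono hsub).trans
    ((h x s⁻¹ (inv_pos.2 hs0) (inv_le_of_inv_le₀ hR hs.le)).trans_eq ?_)
  rw [Real.rpow_neg hs0.le, Real.rpow_two, inv_pow]

end Growth

/-! ### The logarithm of a bump -/

section LogBump

open scoped Real

/-- The function `log (1 + t² d(x, y)²)` of `y`. -/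
def logBump {M : Type*} [MetricSpace M] (t : ℝ) (x y : M) : ℝ := Real.log (1 + t ^ 2 * dist x y ^ 2)

/-- The derivative `2 t² r / (1 + t² r²)` of the radial profile `log (1 + t² r²)` of `logBump`. -/
def radialSlope (t r : ℝ) : ℝ := 2 * t ^ 2 * r / (1 + t ^ 2 * r ^ 2)

variable {t r : ℝ}

theorem one_add_sq_mul_sq_pos (t r : ℝ) : 0 < 1 + t ^ 2 * r ^ 2 := by positivity

theorem hasDerivAt_log_one_add_sq_mul_sq (t r : ℝ) :
    HasDerivAt (fun r ↦ Real.log (1 + t ^ 2 * r ^ 2)) (radialSlope t r) r := by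
  have h := (((hasDerivAt_pow 2 r).const_mul (t ^ 2)).const_add 1).log
    (one_add_sq_mul_sq_pos t r).ne'
  convert h using 1
  simp only [radialSlope, Nat.cast_ofNat, Nat.add_one_sub_one, pow_one]
  ring

theorem continuous_radialSlope (t : ℝ) : Continuous (radialSlope t) :=
  Continuous.div (by fun_prop) (by fun_prop) fun r ↦ (one_add_sq_mul_sq_pos t r).ne'

theorem radialSlope_nonneg (t : ℝ) (hr : 0 ≤ r) : 0 ≤ radialSlope t r := by
  unfold radialSlope
  positivity

theorem abs_radialSlope_le (t r : ℝ) : |radialSlope t r| ≤ |t| := by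
  rw [radialSlope, abs_div, abs_of_pos (one_add_sq_mul_sq_pos t r),
    div_le_iff₀ (one_add_sq_mul_sq_pos t r), abs_mul, abs_of_nonneg (by positivity : 0 ≤ 2 * t ^ 2),
    ← sq_abs t, ← sq_abs r]
  nlinarith [mul_nonneg (abs_nonneg t) (sq_nonneg (|t| * |r| - 1))]

theorem radialSlope_le_two_mul_inv (t : ℝ) (hr : 0 ≤ r) : radialSlope t r ≤ 2 * r⁻¹ := by
  rcases hr.eq_or_lt with rfl | hr
  · simp [radialSlope]
  rw [radialSlope, div_le_iff₀ (one_add_sq_mul_sq_pos t r)]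
  field_simp
  linarith

theorem one_add_sq_mul_sq_le (t r : ℝ) : 1 + t ^ 2 * r ^ 2 ≤ max 1 |t| ^ 2 * (1 + r ^ 2) := by
  have h1 : 1 ≤ max 1 |t| ^ 2 := one_le_pow₀ (le_max_left _ _)
  have ht : t ^ 2 ≤ max 1 |t| ^ 2 := by
    rw [← sq_abs t]
    gcongr
    exact le_max_right _ _
  nlinarith [mul_le_mul_of_nonneg_right ht (sq_nonneg r)]

theorem max_one_abs_mul_sq_le {c : ℝ} (hc : 0 ≤ c) (hc1 : c ≤ 1) (hcr : c ≤ r) :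
    (max 1 |t| * c) ^ 2 ≤ 1 + t ^ 2 * r ^ 2 := by
  have h1 : c ^ 2 ≤ 1 := pow_le_one₀ hc hc1
  have htr : t ^ 2 * c ^ 2 ≤ t ^ 2 * r ^ 2 := by gcongr
  rw [mul_pow]
  rcases max_choice 1 |t| with h | h <;> rw [h]
  · nlinarith [mul_nonneg (sq_nonneg t) (sq_nonneg r)]
  · rw [sq_abs]
    linarith

theorem log_max_one_abs (t : ℝ) : Real.log (max 1 |t|) = log⁺ t := by
  rw [← Real.posLog_eq_log_max_one (abs_nonneg t), Real.posLog_abs]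

variable {M : Type*} [MetricSpace M]

theorem continuous_logBump (t : ℝ) (x : M) : Continuous (logBump t x) :=
  Continuous.log (by fun_prop) fun y ↦ (one_add_sq_mul_sq_pos t (dist x y)).ne'

theorem exp_logBump (t : ℝ) (x y : M) : Real.exp (logBump t x y) = 1 + t ^ 2 * dist x y ^ 2 :=
  Real.exp_log (one_add_sq_mul_sq_pos t (dist x y))

theorem lipschitzWith_logBump (t : ℝ) (x : M) : LipschitzWith ‖t‖₊ (logBump t x) := by
  have h : LipschitzWith ‖t‖₊ fun r : ℝ ↦ Real.log (1 + t ^ 2 * r ^ 2) :=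
    lipschitzWith_of_nnnorm_deriv_le
      (fun r ↦ (hasDerivAt_log_one_add_sq_mul_sq t r).differentiableAt) fun r ↦ by
        rw [(hasDerivAt_log_one_add_sq_mul_sq t r).deriv]
        exact abs_radialSlope_le t r
  exact mul_one ‖t‖₊ ▸ h.comp (LipschitzWith.dist_right x)

theorem eventually_abs_logBump_sub_le (t : ℝ) (x y : M) {L : ℝ}
    (hL : radialSlope t (dist x y) < L) :
    ∀ᶠ y' in 𝓝 y, |logBump t x y' - logBump t x y| ≤ L * dist y' y := by
  have hslope := radialSlope_nonneg t (dist_nonneg (x := x) (y := y))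
  have hradial : ∀ᶠ r in 𝓝 (dist x y),
      |Real.log (1 + t ^ 2 * r ^ 2) - Real.log (1 + t ^ 2 * dist x y ^ 2)| ≤
        L * |r - dist x y| := by
    have h := (hasDerivAt_log_one_add_sq_mul_sq t (dist x y)).hasDerivWithinAt.limsup_norm_slope_le
      (s := univ) (by rwa [Real.norm_of_nonneg hslope])
    rw [nhdsWithin_univ] at h
    filter_upwards [h] with r hr
    rcases eq_or_ne r (dist x y) with rfl | hne
    · simp
    · exact ((inv_mul_lt_iff₀' (norm_sub_pos_iff.2 hne)).1 hr).le
  have hdist : Tendsto (dist x) (𝓝 y) (𝓝 (dist x y)) := Continuous.tendsto (by fun_prop) y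
  filter_upwards [hdist.eventually hradial] with y' hy'
  refine hy'.trans (mul_le_mul_of_nonneg_left ?_ (hslope.trans hL.le))
  rw [dist_comm x y', dist_comm x y]
  exact abs_dist_sub_le y' y x

theorem logBump_le (t : ℝ) (x y : M) :
    logBump t x y ≤ 2 * log⁺ t + Real.log (1 + dist x y ^ 2) := by
  have h := Real.log_le_log (one_add_sq_mul_sq_pos t (dist x y)) (one_add_sq_mul_sq_le t (dist x y))
  rw [Real.log_mul (by positivity) (by positivity), Real.log_pow, log_max_one_abs] at h
  exact h

theorem le_logBump (t : ℝ) {x y : M} (hxy : 0 < dist x y) :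
    2 * log⁺ t - 2 * (dist x y)⁻¹ ≤ logBump t x y := by
  have hmin : 0 < min 1 (dist x y) := lt_min one_pos hxy
  have h := Real.log_le_log (by positivity)
    (max_one_abs_mul_sq_le (t := t) hmin.le (min_le_left _ _) (min_le_right _ _))
  rw [Real.log_pow, Real.log_mul (by positivity) hmin.ne', log_max_one_abs] at h
  have hlog : -(dist x y)⁻¹ ≤ Real.log (min 1 (dist x y)) := by
    rcases min_choice 1 (dist x y) with h | h <;> rw [h]
    · simp
    · linarith [Real.one_sub_inv_le_log_of_pos hxy]
  push_cast at h
  unfold logBump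
  linarith

theorem setOf_lt_radialSlope_sq_subset_ball {s : ℝ} (hs : 0 < s) (t : ℝ) (x : M) :
    {y | s < radialSlope t (dist x y) ^ 2} ⊆ Metric.ball x √(4 / s) := by
  intro y hy
  have hlt : s < (2 * (dist x y)⁻¹) ^ 2 :=
    lt_of_lt_of_le hy (pow_le_pow_left₀ (radialSlope_nonneg t dist_nonneg)
      (radialSlope_le_two_mul_inv t dist_nonneg) 2)
  have hd : 0 < dist x y := dist_nonneg.lt_of_ne' fun h ↦ by
    rw [h] at hlt
    norm_num at hlt
    exact hs.not_gt hlt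
  rw [mul_pow, inv_pow, ← div_eq_mul_inv, lt_div_iff₀ (by positivity)] at hlt
  rw [Metric.mem_ball', Real.lt_sqrt dist_nonneg, lt_div_iff₀ hs]
  linarith

variable [MeasurableSpace M] [BorelSpace M] {μ : Measure M} [IsProbabilityMeasure μ] {κ R : ℝ}

theorem UpperRegular.exists_integral_radialSlope_sq_le (hκ : 0 ≤ κ) (hR : 0 < R)
    (h : UpperRegular μ κ R) :
    ∃ C, ∀ (t : ℝ) (x : M), ∫ y, radialSlope t (dist x y) ^ 2 ∂μ ≤ 8 * κ * log⁺ t + C := by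
  set a := 4 / R ^ 2
  have ha0 : 0 < a := by positivity
  refine ⟨a + 4 * κ * Real.log ((1 + a) / a), fun t x ↦ ?_⟩
  set b := (1 + a) * max 1 |t| ^ 2 with hb
  have hmax : 1 ≤ max 1 |t| ^ 2 := one_le_pow₀ (le_max_left _ _)
  have hab : a ≤ b := by nlinarith
  have htb : t ^ 2 ≤ b := by
    have htmax : |t| ^ 2 ≤ max 1 |t| ^ 2 := by
      gcongr
      exact le_max_right _ _
    rw [← sq_abs]
    nlinarith
  have hlog : ∫ s in Ioc a b, 4 * κ * s⁻¹ = 4 * κ * Real.log ((1 + a) / a) + 8 * κ * log⁺ t := by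
    rw [← intervalIntegral.integral_of_le hab, intervalIntegral.integral_const_mul,
      integral_inv_of_pos ha0 (ha0.trans_le hab), hb, mul_div_right_comm,
      Real.log_mul (by positivity) (by positivity), Real.log_pow, log_max_one_abs]
    push_cast
    ring
  have hint : IntegrableOn (fun s : ℝ ↦ 4 * κ * s⁻¹) (Ioc a b) :=
    (intervalIntegrable_iff_integrableOn_Ioc_of_le hab).1
      ((intervalIntegral.intervalIntegrable_inv (fun s hs ↦
        (ha0.trans_le (uIcc_of_le hab ▸ hs).1).ne') continuousOn_id).const_mul _)
  have hmain := (integrable_and_integral_le_of_measure_lt_le (μ := μ)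
    (f := fun y ↦ radialSlope t (dist x y) ^ 2)
    (g := (Ioc a b).indicator fun s ↦ 4 * κ * s⁻¹)
    (((continuous_radialSlope t).comp (by fun_prop)).pow 2).aemeasurable (fun y ↦ sq_nonneg _)
    ha0.le
    ((integrable_indicator_iff measurableSet_Ioc).2 hint).integrableOn
    (fun s _ ↦ indicator_nonneg (fun s hs ↦ by have := ha0.trans hs.1; positivity) s)
    fun s hs ↦ ?_).2
  · rw [setIntegral_indicator measurableSet_Ioc, inter_eq_right.2 Ioc_subset_Ioi_self, hlog]
      at hmain
    linarith
  have hs0 : 0 < s := ha0.trans hs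
  by_cases hsb : s ≤ b
  · rw [indicator_of_mem (show s ∈ Ioc a b from ⟨hs, hsb⟩)]
    refine (measure_mono (setOf_lt_radialSlope_sq_subset_ball hs0 t x)).trans
      ((h x _ (by positivity) ?_).trans_eq ?_)
    · rw [Real.sqrt_le_left hR.le, div_le_comm₀ hs0 (by positivity)]
      exact hs.le
    · rw [Real.sq_sqrt (by positivity)]
      congr 1
      ring
  · have hempty : {y | s < radialSlope t (dist x y) ^ 2} = ∅ :=
      eq_empty_of_forall_notMem fun y hy ↦ hsb <| (le_of_lt hy).trans <|
        (sq_le_sq.2 (abs_radialSlope_le t (dist x y))).trans htb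
    rw [hempty, measure_empty]
    exact zero_le

variable [CompactSpace M]

theorem integrable_of_continuous {f : M → ℝ} (hf : Continuous f) : Integrable f μ :=
  hf.integrable_of_hasCompactSupport (HasCompactSupport.of_compactSpace f)

theorem exists_integral_logBump_le (μ : Measure M) [IsProbabilityMeasure μ] :
    ∃ C, ∀ (t : ℝ) (x : M), ∫ y, logBump t x y ∂μ ≤ 2 * log⁺ t + C := by
  refine ⟨Real.log (1 + Metric.diam (univ : Set M) ^ 2), fun t x ↦ ?_⟩
  have h := integral_mono (integrable_of_continuous (μ := μ) (continuous_logBump t x))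
    (integrable_const (2 * log⁺ t + Real.log (1 + Metric.diam (univ : Set M) ^ 2)))
    fun y ↦ (logBump_le t x y).trans (by
      gcongr
      exact Metric.dist_le_diam_of_mem isCompact_univ.isBounded (mem_univ x) (mem_univ y))
  simpa using h

theorem UpperRegular.exists_le_integral_logBump (hκ : 0 ≤ κ) (hR : 0 < R)
    (h : UpperRegular μ κ R) :
    ∃ C, ∀ (t : ℝ) (x : M), 2 * log⁺ t - C ≤ ∫ y, logBump t x y ∂μ := by
  refine ⟨2 * (R⁻¹ + κ * R), fun t x ↦ ?_⟩
  obtain ⟨hint, hle⟩ := h.integrable_and_integral_inv_dist_le hκ hR x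
  calc 2 * log⁺ t - 2 * (R⁻¹ + κ * R) ≤ 2 * log⁺ t - 2 * ∫ y, (dist x y)⁻¹ ∂μ := by gcongr
    _ = ∫ y, 2 * log⁺ t - 2 * (dist x y)⁻¹ ∂μ := by
      rw [integral_sub (integrable_const _) (hint.const_mul 2), integral_const,
        probReal_univ, one_smul, integral_const_mul]
    _ ≤ ∫ y, logBump t x y ∂μ := by
      refine integral_mono_ae ((integrable_const _).sub (hint.const_mul 2))
        (integrable_of_continuous (continuous_logBump t x)) ?_
      filter_upwards [compl_mem_ae_iff.2 (h.measure_singleton hR x)] with y hy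
      exact le_logBump t (dist_pos.2 fun h ↦ hy h.symm)

end LogBump

/-! ### Bubbles -/

section Bubble

open scoped Real

variable {M : Type*} [MetricSpace M]

/-- The test function `log ((1 + t₂² d(x₂, y)²) / (1 + t₁² d(x₁, y)²)²)` of `y`. The two components
of `φ` are of this form, with the roles of the two points of the cone exchanged. -/
def bubble (t₁ : ℝ) (x₁ : M) (t₂ : ℝ) (x₂ y : M) : ℝ := logBump t₂ x₂ y - 2 * logBump t₁ x₁ y

/-- Either one of the bubbles with parameters `t₁, t₂` is spread out, or their centres `x₁, x₂` are
apart. It is in this form that the definition of `𝒳_ν` enters the estimates. -/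
def NonColliding (C c t₁ t₂ : ℝ) (x₁ x₂ : M) : Prop := |t₁| ≤ C ∨ |t₂| ≤ C ∨ c ≤ dist x₁ x₂

variable {C c t₁ t₂ : ℝ} {x₁ x₂ : M}

theorem NonColliding.symm (h : NonColliding C c t₁ t₂ x₁ x₂) : NonColliding C c t₂ t₁ x₂ x₁ := by
  rw [NonColliding, dist_comm]
  exact or_left_comm.1 h

theorem continuous_bubble (t₁ : ℝ) (x₁ : M) (t₂ : ℝ) (x₂ : M) :
    Continuous (bubble t₁ x₁ t₂ x₂) :=
  (continuous_logBump t₂ x₂).sub (continuous_const.mul (continuous_logBump t₁ x₁))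

theorem exists_lipschitzWith_bubble (t₁ : ℝ) (x₁ : M) (t₂ : ℝ) (x₂ : M) :
    ∃ K, LipschitzWith K (bubble t₁ x₁ t₂ x₂) :=
  ⟨_, (lipschitzWith_logBump t₂ x₂).sub
    ((lipschitzWith_smul (2 : ℝ)).comp (lipschitzWith_logBump t₁ x₁))⟩

theorem exp_bubble (t₁ : ℝ) (x₁ : M) (t₂ : ℝ) (x₂ y : M) :
    Real.exp (bubble t₁ x₁ t₂ x₂ y) =
      (1 + t₂ ^ 2 * dist x₂ y ^ 2) / (1 + t₁ ^ 2 * dist x₁ y ^ 2) ^ 2 := by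
  rw [bubble, Real.exp_sub, two_mul, Real.exp_add, exp_logBump, exp_logBump, sq (1 + _)]

theorem NonColliding.radialSlope_le_or (hc : 0 < c) (h : NonColliding C c t₁ t₂ x₁ x₂) (y : M) :
    radialSlope t₁ (dist x₁ y) ≤ max C (4 / c) ∨ radialSlope t₂ (dist x₂ y) ≤ max C (4 / c) := by
  have of_spread {t : ℝ} {x : M} (ht : |t| ≤ C) : radialSlope t (dist x y) ≤ max C (4 / c) :=
    ((le_abs_self _).trans (abs_radialSlope_le t _)).trans (ht.trans (le_max_left _ _))
  have of_far {t : ℝ} {x : M} (hx : c / 2 ≤ dist x y) :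
      radialSlope t (dist x y) ≤ max C (4 / c) :=
    calc radialSlope t (dist x y) ≤ 2 * (dist x y)⁻¹ := radialSlope_le_two_mul_inv t dist_nonneg
      _ ≤ 2 * (c / 2)⁻¹ := by gcongr
      _ = 4 / c := by field_simp; norm_num
      _ ≤ max C (4 / c) := le_max_right _ _
  rcases h with h | h | h
  · exact .inl (of_spread h)
  · exact .inr (of_spread h)
  · rcases le_total (c / 2) (dist x₁ y) with h₁ | h₁
    · exact .inl (of_far h₁)
    · exact .inr (of_far (by linarith [dist_triangle_right x₁ x₂ y]))

theorem NonColliding.radialSlope_mul_le (hc : 0 < c) (h : NonColliding C c t₁ t₂ x₁ x₂) (y : M) :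
    radialSlope t₁ (dist x₁ y) * radialSlope t₂ (dist x₂ y) ≤
      2 * max C (4 / c) * ((dist x₁ y)⁻¹ + (dist x₂ y)⁻¹) := by
  have hK : 0 ≤ max C (4 / c) := le_max_of_le_right (by positivity)
  have h₁ := radialSlope_le_two_mul_inv t₁ (dist_nonneg (x := x₁) (y := y))
  have h₂ := radialSlope_le_two_mul_inv t₂ (dist_nonneg (x := x₂) (y := y))
  have hd₁ : 0 ≤ (dist x₁ y)⁻¹ := by positivity
  have hd₂ : 0 ≤ (dist x₂ y)⁻¹ := by positivity
  rcases h.radialSlope_le_or hc y with hs | hs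
  · nlinarith [mul_le_mul hs h₂ (radialSlope_nonneg t₂ dist_nonneg) hK, mul_nonneg hK hd₁]
  · nlinarith [mul_le_mul h₁ hs (radialSlope_nonneg t₂ dist_nonneg) (by positivity),
      mul_nonneg hK hd₂]

variable [CompactSpace M] [MeasurableSpace M] [BorelSpace M] {μ : Measure M}
  [IsProbabilityMeasure μ] {h : M → ℝ} {m κ R : ℝ}

theorem mul_div_sq_mul_measureReal_le_integral_mul_exp_bubble (hh : Continuous h) (hm : 0 ≤ m)
    (hmh : ∀ y, m ≤ h y) {S : Set M} (hS : MeasurableSet S) {A B : ℝ}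
    (hA : ∀ y ∈ S, 1 + t₁ ^ 2 * dist x₁ y ^ 2 ≤ A) (hB : ∀ y ∈ S, B ≤ 1 + t₂ ^ 2 * dist x₂ y ^ 2) :
    m * (B / A ^ 2) * μ.real S ≤ ∫ y, h y * Real.exp (bubble t₁ x₁ t₂ x₂ y) ∂μ := by
  have hint : Integrable (fun y ↦ h y * Real.exp (bubble t₁ x₁ t₂ x₂ y)) μ :=
    integrable_of_continuous (hh.mul (continuous_bubble t₁ x₁ t₂ x₂).rexp)
  have hS' : ∀ y ∈ S, m * (B / A ^ 2) ≤ h y * Real.exp (bubble t₁ x₁ t₂ x₂ y) := fun y hy ↦ by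
    rw [exp_bubble]
    have hpos₁ := one_add_sq_mul_sq_pos t₁ (dist x₁ y)
    have hpos₂ := one_add_sq_mul_sq_pos t₂ (dist x₂ y)
    have hquot := div_le_div₀ hpos₂.le (hB y hy) (by positivity)
      (pow_le_pow_left₀ hpos₁.le (hA y hy) 2)
    exact (mul_le_mul_of_nonneg_left hquot hm).trans
      (mul_le_mul_of_nonneg_right (hmh y) (by positivity))
  calc m * (B / A ^ 2) * μ.real S ≤ ∫ y in S, h y * Real.exp (bubble t₁ x₁ t₂ x₂ y) ∂μ :=
        setIntegral_ge_of_const_le_real hS (measure_ne_top μ S) hS' hint.integrableOn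
    _ ≤ ∫ y, h y * Real.exp (bubble t₁ x₁ t₂ x₂ y) ∂μ :=
        setIntegral_le_integral hint (Eventually.of_forall fun y ↦
          mul_nonneg (hm.trans (hmh y)) (Real.exp_pos _).le)

/-- If the first bubble is spread out, the mass is bounded below away from the point `x₂`. -/
theorem UpperRegular.exists_le_integral_mul_exp_bubble (hR : 0 < R) (hup : UpperRegular μ κ R)
    (hh : Continuous h) (hm : 0 < m) (hmh : ∀ y, m ≤ h y) (C : ℝ) :
    ∃ q > 0, ∀ (t₁ t₂ : ℝ) (x₁ x₂ : M), |t₁| ≤ C →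
      q * (max 1 |t₂| / max 1 |t₁|) ^ 2 ≤ ∫ y, h y * Real.exp (bubble t₁ x₁ t₂ x₂ y) ∂μ := by
  obtain ⟨r, ⟨hr, hr1⟩, hhalf⟩ := hup.exists_half_le_measureReal_compl_ball hR
  set A := 1 + C ^ 2 * Metric.diam (univ : Set M) ^ 2
  refine ⟨m * (r ^ 2 / A ^ 2) * (1 / 2), by positivity, fun t₁ t₂ x₁ x₂ ht₁ ↦ ?_⟩
  have hA : ∀ y ∈ (Metric.ball x₂ r)ᶜ, 1 + t₁ ^ 2 * dist x₁ y ^ 2 ≤ A := fun y _ ↦ by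
    have ht : t₁ ^ 2 ≤ C ^ 2 := sq_le_sq.2 (ht₁.trans (le_abs_self C))
    have hd : dist x₁ y ≤ Metric.diam (univ : Set M) :=
      Metric.dist_le_diam_of_mem isCompact_univ.isBounded (mem_univ x₁) (mem_univ y)
    simp only [A]
    gcongr
  have hB : ∀ y ∈ (Metric.ball x₂ r)ᶜ, (max 1 |t₂| * r) ^ 2 ≤ 1 + t₂ ^ 2 * dist x₂ y ^ 2 :=
    fun y hy ↦ max_one_abs_mul_sq_le hr.le hr1 (not_lt.1 fun hlt ↦ hy (Metric.mem_ball'.2 hlt))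
  have hdiv : max 1 |t₂| / max 1 |t₁| ≤ max 1 |t₂| :=
    div_le_self (by positivity) (le_max_left _ _)
  calc m * (r ^ 2 / A ^ 2) * (1 / 2) * (max 1 |t₂| / max 1 |t₁|) ^ 2
      ≤ m * (r ^ 2 / A ^ 2) * (1 / 2) * max 1 |t₂| ^ 2 := by gcongr
    _ = m * ((max 1 |t₂| * r) ^ 2 / A ^ 2) * (1 / 2) := by ring
    _ ≤ m * ((max 1 |t₂| * r) ^ 2 / A ^ 2) * μ.real (Metric.ball x₂ r)ᶜ := by
      gcongr
      exact hhalf x₂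
    _ ≤ ∫ y, h y * Real.exp (bubble t₁ x₁ t₂ x₂ y) ∂μ :=
      mul_div_sq_mul_measureReal_le_integral_mul_exp_bubble hh hm.le hmh
        Metric.isOpen_ball.measurableSet.compl hA hB

/-- If the first bubble is concentrated, the mass is bounded below on a ball of radius comparable
to `1 / t₁` around its centre. -/
theorem LowerRegular.exists_le_integral_mul_exp_bubble (hκ : 0 < κ) (hR : 0 < R)
    (hlow : LowerRegular μ κ R) (hh : Continuous h) (hm : 0 < m) (hmh : ∀ y, m ≤ h y) (C : ℝ)
    (hc : 0 < c) :
    ∃ q > 0, ∀ (t₁ t₂ : ℝ) (x₁ x₂ : M), |t₂| ≤ C ∨ c ≤ dist x₁ x₂ →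
      q * (max 1 |t₂| / max 1 |t₁|) ^ 2 ≤ ∫ y, h y * Real.exp (bubble t₁ x₁ t₂ x₂ y) ∂μ := by
  set r := min (min R 1) (c / 2)
  have hr : 0 < r := by positivity
  have hr1 : r ≤ 1 := (min_le_left _ _).trans (min_le_right _ _)
  set b := min (max 1 C)⁻¹ r
  have hb : 0 < b := by positivity
  refine ⟨m * (b ^ 2 / 2 ^ 2) * (κ * r ^ 2), by positivity, fun t₁ t₂ x₁ x₂ hsep ↦ ?_⟩
  set T := max 1 |t₁|
  have hT1 : 1 ≤ T := le_max_left _ _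
  have hrT : r / T ≤ r := div_le_self hr.le hT1
  have hA : ∀ y ∈ Metric.ball x₁ (r / T), 1 + t₁ ^ 2 * dist x₁ y ^ 2 ≤ 2 := fun y hy ↦ by
    have htr : |t₁| * dist x₁ y ≤ 1 :=
      calc |t₁| * dist x₁ y ≤ T * (r / T) :=
            mul_le_mul (le_max_right _ _) (Metric.mem_ball'.1 hy).le dist_nonneg (by positivity)
        _ = r := mul_div_cancel₀ r (by positivity)
        _ ≤ 1 := hr1
    have hsq := pow_le_one₀ (n := 2) (by positivity) htr
    rw [mul_pow, sq_abs] at hsq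
    linarith
  have hB : ∀ y ∈ Metric.ball x₁ (r / T), (max 1 |t₂| * b) ^ 2 ≤ 1 + t₂ ^ 2 * dist x₂ y ^ 2 := by
    intro y hy
    rcases hsep with hspread | hfar
    · have hle : max 1 |t₂| * b ≤ 1 :=
        calc max 1 |t₂| * b ≤ max 1 C * (max 1 C)⁻¹ := by
              gcongr
              exact min_le_left _ _
          _ = 1 := mul_inv_cancel₀ (by positivity)
      linarith [pow_le_one₀ (n := 2) (by positivity) hle,
        mul_nonneg (sq_nonneg t₂) (sq_nonneg (dist x₂ y))]
    · refine max_one_abs_mul_sq_le hb.le ((min_le_right _ _).trans hr1) ?_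
      have hrc : r ≤ c / 2 := min_le_right _ _
      have hbr : b ≤ r := min_le_right _ _
      linarith [dist_triangle_right x₁ x₂ y, Metric.mem_ball'.1 hy]
  have hball : κ * (r / T) ^ 2 ≤ μ.real (Metric.ball x₁ (r / T)) :=
    (ENNReal.ofReal_le_iff_le_toReal (measure_ne_top _ _)).1
      (hlow x₁ _ (by positivity) (hrT.trans ((min_le_left _ _).trans (min_le_left _ _))))
  calc m * (b ^ 2 / 2 ^ 2) * (κ * r ^ 2) * (max 1 |t₂| / T) ^ 2
      = m * ((max 1 |t₂| * b) ^ 2 / 2 ^ 2) * (κ * (r / T) ^ 2) := by ring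
    _ ≤ m * ((max 1 |t₂| * b) ^ 2 / 2 ^ 2) * μ.real (Metric.ball x₁ (r / T)) := by gcongr
    _ ≤ ∫ y, h y * Real.exp (bubble t₁ x₁ t₂ x₂ y) ∂μ :=
      mul_div_sq_mul_measureReal_le_integral_mul_exp_bubble hh hm.le hmh
        Metric.isOpen_ball.measurableSet hA hB

theorem neg_log_le_of_mul_div_sq_le {q I : ℝ} (hq : 0 < q) (t₁ t₂ : ℝ)
    (h : q * (max 1 |t₂| / max 1 |t₁|) ^ 2 ≤ I) :
    -Real.log I ≤ 2 * log⁺ t₁ - 2 * log⁺ t₂ - Real.log q := by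
  have hlog := Real.log_le_log (by positivity) h
  rw [Real.log_mul hq.ne' (by positivity), Real.log_pow, Real.log_div (by positivity)
    (by positivity), log_max_one_abs, log_max_one_abs] at hlog
  push_cast at hlog
  linarith

theorem exists_neg_log_integral_mul_exp_bubble_le {κ' R' : ℝ} (hR : 0 < R)
    (hup : UpperRegular μ κ R) (hκ' : 0 < κ') (hR' : 0 < R') (hlow : LowerRegular μ κ' R')
    (hh : Continuous h) (hpos : ∀ y, 0 < h y) (C : ℝ) (hc : 0 < c) :
    ∃ C', ∀ (t₁ t₂ : ℝ) (x₁ x₂ : M), NonColliding C c t₁ t₂ x₁ x₂ →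
      -Real.log (∫ y, h y * Real.exp (bubble t₁ x₁ t₂ x₂ y) ∂μ) ≤
        2 * log⁺ t₁ - 2 * log⁺ t₂ + C' := by
  obtain ⟨m, hm, hmh⟩ := isCompact_univ.exists_forall_le' hh.continuousOn fun y _ ↦ hpos y
  obtain ⟨q₁, hq₁, h₁⟩ :=
    hup.exists_le_integral_mul_exp_bubble hR hh hm (fun y ↦ hmh y (mem_univ y)) C
  obtain ⟨q₂, hq₂, h₂⟩ :=
    hlow.exists_le_integral_mul_exp_bubble hκ' hR' hh hm (fun y ↦ hmh y (mem_univ y)) C hc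
  refine ⟨max (-Real.log q₁) (-Real.log q₂), fun t₁ t₂ x₁ x₂ hsep ↦ ?_⟩
  rcases hsep with hspread | hsep
  · linarith [neg_log_le_of_mul_div_sq_le hq₁ t₁ t₂ (h₁ t₁ t₂ x₁ x₂ hspread),
      le_max_left (-Real.log q₁) (-Real.log q₂)]
  · linarith [neg_log_le_of_mul_div_sq_le hq₂ t₁ t₂ (h₂ t₁ t₂ x₁ x₂ hsep),
      le_max_right (-Real.log q₁) (-Real.log q₂)]

theorem UpperRegular.exists_integral_bubble_le (hκ : 0 ≤ κ) (hR : 0 < R)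
    (hup : UpperRegular μ κ R) :
    ∃ C, ∀ (t₁ t₂ : ℝ) (x₁ x₂ : M),
      ∫ y, bubble t₁ x₁ t₂ x₂ y ∂μ ≤ 2 * log⁺ t₂ - 4 * log⁺ t₁ + C := by
  obtain ⟨C₁, h₁⟩ := hup.exists_le_integral_logBump hκ hR
  obtain ⟨C₂, h₂⟩ := exists_integral_logBump_le μ
  refine ⟨C₂ + 2 * C₁, fun t₁ t₂ x₁ x₂ ↦ ?_⟩
  have hsub : ∫ y, bubble t₁ x₁ t₂ x₂ y ∂μ =
      ∫ y, logBump t₂ x₂ y ∂μ - 2 * ∫ y, logBump t₁ x₁ y ∂μ := by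
    rw [← integral_const_mul]
    exact integral_sub (integrable_of_continuous (continuous_logBump t₂ x₂))
      ((integrable_of_continuous (continuous_logBump t₁ x₁)).const_mul 2)
  linarith [h₁ t₁ x₁, h₂ t₂ x₂]

theorem exists_integral_bubble_sub_log_le {κ' R' : ℝ} (hκ : 0 ≤ κ) (hR : 0 < R)
    (hup : UpperRegular μ κ R) (hκ' : 0 < κ') (hR' : 0 < R') (hlow : LowerRegular μ κ' R')
    (hh : Continuous h) (hpos : ∀ y, 0 < h y) (C : ℝ) (hc : 0 < c) :
    ∃ C', ∀ (t₁ t₂ : ℝ) (x₁ x₂ : M), NonColliding C c t₁ t₂ x₁ x₂ →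
      ∫ y, bubble t₁ x₁ t₂ x₂ y ∂μ -
        Real.log (∫ y, h y * Real.exp (bubble t₁ x₁ t₂ x₂ y) ∂μ) ≤ C' - 2 * log⁺ t₁ := by
  obtain ⟨C₁, h₁⟩ := hup.exists_integral_bubble_le hκ hR
  obtain ⟨C₂, h₂⟩ := exists_neg_log_integral_mul_exp_bubble_le hR hup hκ' hR' hlow hh hpos C hc
  refine ⟨C₁ + C₂, fun t₁ t₂ x₁ x₂ hsep ↦ ?_⟩
  linarith [h₁ t₁ t₂ x₁ x₂, h₂ t₁ t₂ x₁ x₂ hsep]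

end Bubble

/-! ### The energy of a pair of bubbles -/

section Energy

open scoped Real

theorem inner_combination_eq {V : Type*} [NormedAddCommGroup V] [InnerProductSpace ℝ V] (a b : V) :
    1 / 3 * (‖b - (2 : ℝ) • a‖ ^ 2 + ‖a - (2 : ℝ) • b‖ ^ 2 +
      inner ℝ (b - (2 : ℝ) • a) (a - (2 : ℝ) • b)) = ‖a‖ ^ 2 + ‖b‖ ^ 2 - inner ℝ a b := by
  simp only [← real_inner_self_eq_norm_sq, inner_sub_left, inner_sub_right, real_inner_smul_left,
    real_inner_smul_right, real_inner_comm a b]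
  ring

theorem norm_sq_add_norm_sq_sub_inner_nonneg {V : Type*} [NormedAddCommGroup V]
    [InnerProductSpace ℝ V] (a b : V) : 0 ≤ ‖a‖ ^ 2 + ‖b‖ ^ 2 - inner ℝ a b := by
  nlinarith [real_inner_le_norm a b, sq_nonneg (‖a‖ - ‖b‖)]

variable {M : Type*} [MetricSpace M] [ChartedSpace Plane M] [IsManifold (𝓡 2) 1 M]
  [RiemannianBundle (fun x : M ↦ TangentSpace (𝓡 2) x)]
  [IsContinuousRiemannianBundle Plane (fun x : M ↦ TangentSpace (𝓡 2) x)]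
  [IsRiemannianManifold (𝓡 2) M]

theorem norm_riemGrad_logBump_le (t : ℝ) (x y : M) :
    ‖riemGrad (logBump t x) y‖ ≤ radialSlope t (dist x y) :=
  norm_riemGrad_le (radialSlope_nonneg t dist_nonneg) fun _ ↦ eventually_abs_logBump_sub_le t x y

variable [CompactSpace M] [MeasurableSpace M] [BorelSpace M]

section FiniteVolume

variable [IsFiniteMeasure (riemVolume M)]

theorem memH1_bubble (t₁ : ℝ) (x₁ : M) (t₂ : ℝ) (x₂ : M) : MemH1 (bubble t₁ x₁ t₂ x₂) :=
  let ⟨_, hK⟩ := exists_lipschitzWith_bubble t₁ x₁ t₂ x₂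
  memH1_of_lipschitzWith hK

theorem ae_grad_bubble (t₁ : ℝ) (x₁ : M) (t₂ : ℝ) (x₂ : M) :
    ∀ᵐ y ∂riemVolume M, grad (bubble t₁ x₁ t₂ x₂) y =
      riemGrad (logBump t₂ x₂) y - (2 : ℝ) • riemGrad (logBump t₁ x₁) y := by
  obtain ⟨K, hK⟩ := exists_lipschitzWith_bubble t₁ x₁ t₂ x₂
  filter_upwards [ae_grad_eq_riemGrad hK,
    ae_mdifferentiableAt (lipschitzWith_logBump t₁ x₁).locallyLipschitz,
    ae_mdifferentiableAt (lipschitzWith_logBump t₂ x₂).locallyLipschitz] with y hgrad h₁ h₂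
  rw [hgrad]
  exact riemGrad_sub_const_mul h₂ h₁ 2

theorem ae_Q_bubble_eq (t₁ t₂ : ℝ) (x₁ x₂ : M) :
    ∀ᵐ y ∂riemVolume M, Q (bubble t₁ x₁ t₂ x₂) (bubble t₂ x₂ t₁ x₁) y =
      ‖riemGrad (logBump t₁ x₁) y‖ ^ 2 + ‖riemGrad (logBump t₂ x₂) y‖ ^ 2 -
        inner ℝ (riemGrad (logBump t₁ x₁) y) (riemGrad (logBump t₂ x₂) y) := by
  filter_upwards [ae_grad_bubble t₁ x₁ t₂ x₂, ae_grad_bubble t₂ x₂ t₁ x₁] with y h₁ h₂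
  rw [Q, h₁, h₂, inner_combination_eq]

theorem ae_Q_bubble_le (t₁ t₂ : ℝ) (x₁ x₂ : M) :
    ∀ᵐ y ∂riemVolume M, Q (bubble t₁ x₁ t₂ x₂) (bubble t₂ x₂ t₁ x₁) y ≤
      radialSlope t₁ (dist x₁ y) ^ 2 + radialSlope t₂ (dist x₂ y) ^ 2 +
        radialSlope t₁ (dist x₁ y) * radialSlope t₂ (dist x₂ y) := by
  filter_upwards [ae_Q_bubble_eq t₁ t₂ x₁ x₂] with y hQ
  have h₁ := norm_riemGrad_logBump_le t₁ x₁ y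
  have h₂ := norm_riemGrad_logBump_le t₂ x₂ y
  rw [hQ, sub_eq_add_neg, ← inner_neg_left]
  calc _ ≤ ‖riemGrad (logBump t₁ x₁) y‖ ^ 2 + ‖riemGrad (logBump t₂ x₂) y‖ ^ 2 +
        ‖riemGrad (logBump t₁ x₁) y‖ * ‖riemGrad (logBump t₂ x₂) y‖ := by
        gcongr
        exact (real_inner_le_norm _ _).trans_eq (by rw [norm_neg])
    _ ≤ _ := by
        gcongr
        exact radialSlope_nonneg t₁ dist_nonneg

end FiniteVolume

variable [IsProbabilityMeasure (riemVolume M)] {κ R C c : ℝ}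

theorem UpperRegular.exists_integral_Q_bubble_le (hκ : 0 ≤ κ) (hR : 0 < R)
    (hup : UpperRegular (riemVolume M) κ R) (C : ℝ) (hc : 0 < c) :
    ∃ C', ∀ (t₁ t₂ : ℝ) (x₁ x₂ : M), NonColliding C c t₁ t₂ x₁ x₂ →
      ∫ y, Q (bubble t₁ x₁ t₂ x₂) (bubble t₂ x₂ t₁ x₁) y ∂riemVolume M ≤
        8 * κ * (log⁺ t₁ + log⁺ t₂) + C' := by
  obtain ⟨C₁, h₁⟩ := hup.exists_integral_radialSlope_sq_le hκ hR
  set K := 2 * max C (4 / c)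
  have : 0 ≤ K := mul_nonneg zero_le_two (le_max_of_le_right (by positivity))
  refine ⟨2 * C₁ + K * (2 * (R⁻¹ + κ * R)), fun t₁ t₂ x₁ x₂ hsep ↦ ?_⟩
  have hsq (t : ℝ) (x : M) : Integrable (fun y ↦ radialSlope t (dist x y) ^ 2) (riemVolume M) :=
    integrable_of_continuous (((continuous_radialSlope t).comp (by fun_prop)).pow 2)
  obtain ⟨hinv₁, hle₁⟩ := hup.integrable_and_integral_inv_dist_le hκ hR x₁
  obtain ⟨hinv₂, hle₂⟩ := hup.integrable_and_integral_inv_dist_le hκ hR x₂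
  have hsqs := (hsq t₁ x₁).add (hsq t₂ x₂)
  have hinvs := (hinv₁.add hinv₂).const_mul K
  calc ∫ y, Q (bubble t₁ x₁ t₂ x₂) (bubble t₂ x₂ t₁ x₁) y ∂riemVolume M
      ≤ ∫ y, radialSlope t₁ (dist x₁ y) ^ 2 + radialSlope t₂ (dist x₂ y) ^ 2 +
          K * ((dist x₁ y)⁻¹ + (dist x₂ y)⁻¹) ∂riemVolume M := by
        refine integral_mono_of_nonneg ?_ (hsqs.add hinvs) ?_
        · filter_upwards [ae_Q_bubble_eq t₁ t₂ x₁ x₂] with y hy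
          exact hy ▸ norm_sq_add_norm_sq_sub_inner_nonneg _ _
        · filter_upwards [ae_Q_bubble_le t₁ t₂ x₁ x₂] with y hy
          exact hy.trans (add_le_add_right (hsep.radialSlope_mul_le hc y) _)
    _ = ∫ y, radialSlope t₁ (dist x₁ y) ^ 2 ∂riemVolume M +
          ∫ y, radialSlope t₂ (dist x₂ y) ^ 2 ∂riemVolume M +
          K * (∫ y, (dist x₁ y)⁻¹ ∂riemVolume M + ∫ y, (dist x₂ y)⁻¹ ∂riemVolume M) := by
        rw [← integral_add (hsq t₁ x₁) (hsq t₂ x₂), ← integral_add hinv₁ hinv₂,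
          ← integral_const_mul]
        exact integral_add hsqs hinvs
    _ ≤ 8 * κ * log⁺ t₁ + C₁ + (8 * κ * log⁺ t₂ + C₁) +
          K * (R⁻¹ + κ * R + (R⁻¹ + κ * R)) := by
        gcongr
        · exact h₁ t₁ x₁
        · exact h₁ t₂ x₂
    _ = 8 * κ * (log⁺ t₁ + log⁺ t₂) + (2 * C₁ + K * (2 * (R⁻¹ + κ * R))) := by ring

/-- The energy contributes `8π log⁺ tᵢ` up to a small error, the logarithmic terms `-2ρᵢ log⁺ tᵢ`:
this is where the threshold `4π` comes from. -/
theorem exists_J_bubble_le {h₁ h₂ : M → ℝ} (hh₁ : Continuous h₁) (hh₂ : Continuous h₂)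
    (hpos₁ : ∀ x, 0 < h₁ x) (hpos₂ : ∀ x, 0 < h₂ x) {ρ₁ ρ₂ : ℝ} (hρ₁ : 4 * π < ρ₁)
    (hρ₂ : 4 * π < ρ₂) (C : ℝ) (hc : 0 < c) :
    ∃ a > 0, ∃ C', ∀ (t₁ t₂ : ℝ) (x₁ x₂ : M), NonColliding C c t₁ t₂ x₁ x₂ →
      J ρ₁ ρ₂ h₁ h₂ (bubble t₁ x₁ t₂ x₂) (bubble t₂ x₂ t₁ x₁) ≤
        C' - a * (log⁺ t₁ + log⁺ t₂) := by
  obtain ⟨κ, hπκ, hκρ⟩ : ∃ κ, π < κ ∧ κ < min ρ₁ ρ₂ / 4 :=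
    exists_between (by linarith [lt_min hρ₁ hρ₂])
  have hκ : 0 < κ := Real.pi_pos.trans hπκ
  obtain ⟨R, hR, hup⟩ := exists_upperRegular (M := M) hπκ
  obtain ⟨R', hR', hlow⟩ := exists_lowerRegular (M := M) (κ := 1) (by linarith [Real.pi_gt_three])
  obtain ⟨C₀, hQ⟩ := hup.exists_integral_Q_bubble_le hκ.le hR C hc
  obtain ⟨C₁, hlog₁⟩ :=
    exists_integral_bubble_sub_log_le hκ.le hR hup one_pos hR' hlow hh₁ hpos₁ C hc
  obtain ⟨C₂, hlog₂⟩ :=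
    exists_integral_bubble_sub_log_le hκ.le hR hup one_pos hR' hlow hh₂ hpos₂ C hc
  refine ⟨2 * min ρ₁ ρ₂ - 8 * κ, by linarith, C₀ + ρ₁ * C₁ + ρ₂ * C₂,
    fun t₁ t₂ x₁ x₂ hsep ↦ ?_⟩
  have hρ₁0 : 0 ≤ ρ₁ := (mul_pos four_pos Real.pi_pos).le.trans hρ₁.le
  have hρ₂0 : 0 ≤ ρ₂ := (mul_pos four_pos Real.pi_pos).le.trans hρ₂.le
  calc J ρ₁ ρ₂ h₁ h₂ (bubble t₁ x₁ t₂ x₂) (bubble t₂ x₂ t₁ x₁)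
      ≤ 8 * κ * (log⁺ t₁ + log⁺ t₂) + C₀ +
          (ρ₁ * (C₁ - 2 * log⁺ t₁) + ρ₂ * (C₂ - 2 * log⁺ t₂)) :=
        add_le_add (hQ t₁ t₂ x₁ x₂ hsep) <| add_le_add
          (mul_le_mul_of_nonneg_left (hlog₁ t₁ t₂ x₁ x₂ hsep) hρ₁0)
          (mul_le_mul_of_nonneg_left (hlog₂ t₂ t₁ x₂ x₁ hsep.symm) hρ₂0)
    _ ≤ C₀ + ρ₁ * C₁ + ρ₂ * C₂ - (2 * min ρ₁ ρ₂ - 8 * κ) * (log⁺ t₁ + log⁺ t₂) := by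
        linarith [mul_le_mul_of_nonneg_right (min_le_left ρ₁ ρ₂) (Real.posLog_nonneg (x := t₁)),
          mul_le_mul_of_nonneg_right (min_le_right ρ₁ ρ₂) (Real.posLog_nonneg (x := t₂))]

end Energy

/-! ### The parameters -/

section ConeParameters

open scoped Real

variable {M : Type*} [MetricSpace M] {δ ν : ℝ}

theorem tilde_self (hδ : 0 < δ) : tilde δ δ = 0 := by
  simp [tilde, hδ]

theorem abs_tilde_le (hδ : 0 < δ) {t : ℝ} (ht : δ ^ 2 / 2 ≤ t) (htδ : t ≤ δ) :
    |tilde δ t| ≤ 2 / δ ^ 2 + 2 / δ := by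
  have h₁ : 0 < 2 / δ ^ 2 := by positivity
  have h₂ : 0 < 2 / δ := by positivity
  unfold tilde
  split_ifs with h
  · have ht0 : 0 < t := lt_of_lt_of_le (by positivity) ht
    have hinv : 1 / t ≤ 2 / δ ^ 2 := by
      rw [div_le_div_iff₀ ht0 (by positivity)]
      linarith
    rw [abs_of_pos (by positivity)]
    linarith
  · have hlin : 4 / δ ^ 2 * (δ - t) ≤ 2 / δ :=
      calc 4 / δ ^ 2 * (δ - t) ≤ 4 / δ ^ 2 * (δ / 2) := by
            gcongr
            linarith
        _ = 2 / δ := by field_simp; norm_num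
    have hnonneg : 0 ≤ 4 / δ ^ 2 * (δ - t) := mul_nonneg (by positivity) (by linarith)
    rw [show -(4 / δ ^ 2) * (t - δ) = 4 / δ ^ 2 * (δ - t) by ring, abs_of_nonneg hnonneg]
    linarith

theorem neg_log_le_posLog_tilde {t : ℝ} (ht : 0 < t) (htν : t ≤ ν) (hν : ν ≤ δ / 2) :
    -Real.log ν ≤ log⁺ (tilde δ t) := by
  rw [show tilde δ t = t⁻¹ by rw [tilde, if_pos (htν.trans hν), one_div]]
  refine le_trans ?_ (le_max_right 0 _)
  rw [Real.log_inv]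
  exact neg_le_neg (Real.log_le_log ht htν)

theorem nonColliding_of_le_sq_add_sq (hδ : 0 < δ) {t₁ t₂ : ℝ} {x₁ x₂ : M} (ht₁ : t₁ ≤ δ)
    (ht₂ : t₂ ≤ δ) (h : δ ^ 4 ≤ |t₁ - t₂| ^ 2 + dist x₁ x₂ ^ 2) (h₁ : 0 < t₁) (h₂ : 0 < t₂) :
    NonColliding (2 / δ ^ 2 + 2 / δ) (δ ^ 2 / 2) (tilde δ t₁) (tilde δ t₂) x₁ x₂ := by
  by_cases hlarge₁ : δ ^ 2 / 2 ≤ t₁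
  · exact .inl (abs_tilde_le hδ hlarge₁ ht₁)
  by_cases hlarge₂ : δ ^ 2 / 2 ≤ t₂
  · exact .inr (.inl (abs_tilde_le hδ hlarge₂ ht₂))
  have hdiff : |t₁ - t₂| ^ 2 ≤ (δ ^ 2 / 2) ^ 2 := by
    gcongr
    rw [abs_le]
    constructor <;> linarith
  refine .inr (.inr (le_of_sq_le_sq ?_ dist_nonneg))
  nlinarith [sq_nonneg (δ ^ 2)]

theorem nonColliding_of_max_eq (hδ : 0 < δ) {t₁ t₂ : ℝ} (x₁ x₂ : M) (h : max t₁ t₂ = δ) :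
    NonColliding (2 / δ ^ 2 + 2 / δ) (δ ^ 2 / 2) (tilde δ t₁) (tilde δ t₂) x₁ x₂ := by
  have hzero : |tilde δ δ| ≤ 2 / δ ^ 2 + 2 / δ := by
    rw [tilde_self hδ, abs_zero]
    positivity
  rcases max_choice t₁ t₂ with hmax | hmax <;> rw [h] at hmax
  · exact .inl (hmax ▸ hzero)
  · exact .inr (.inl (hmax ▸ hzero))

theorem log_bump_div_bump_sq (hδ : 0 < δ) {t₁ t₂ : Ioi (0 : ℝ)} (ht₁ : (t₁ : ℝ) ≤ δ)
    (ht₂ : (t₂ : ℝ) ≤ δ) (x₁ x₂ y : M) :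
    Real.log (bump (Cone.mk δ x₂ t₂) y / bump (Cone.mk δ x₁ t₁) y ^ 2) =
      bubble (tilde δ t₁) x₁ (tilde δ t₂) x₂ y := by
  rw [bump_mk hδ x₁ t₁ ht₁, bump_mk hδ x₂ t₂ ht₂, ← exp_bubble, Real.log_exp]

theorem exists_bubble_of_mem_Xν (hδ : 0 < δ) {p : Cone M δ × Cone M δ} (hp : p ∈ Xν M δ ν) :
    ∃ (x₁ x₂ : M) (t₁ t₂ : ℝ), 0 < t₁ ∧ 0 < t₂ ∧ min t₁ t₂ ≤ ν ∧
      NonColliding (2 / δ ^ 2 + 2 / δ) (δ ^ 2 / 2) (tilde δ t₁) (tilde δ t₂) x₁ x₂ ∧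
      φ₁ p = bubble (tilde δ t₁) x₁ (tilde δ t₂) x₂ ∧
      φ₂ p = bubble (tilde δ t₂) x₂ (tilde δ t₁) x₁ := by
  rcases hp with ⟨-, x₁, x₂, t₁, t₂, rfl, hdist, hmax, hmin⟩ |
    ⟨-, x₁, x₂, t₁, t₂, rfl, hmax, hmin⟩
  all_goals
    have h₁ := (le_max_left _ _).trans hmax.le
    have h₂ := (le_max_right _ _).trans hmax.le
    refine ⟨x₁, x₂, t₁, t₂, t₁.2, t₂.2, hmin.2, ?_,
      funext fun y ↦ log_bump_div_bump_sq hδ h₁ h₂ x₁ x₂ y,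
      funext fun y ↦ log_bump_div_bump_sq hδ h₂ h₁ x₂ x₁ y⟩
  · exact nonColliding_of_le_sq_add_sq hδ h₁ h₂ hdist t₁.2 t₂.2
  · exact nonColliding_of_max_eq hδ x₁ x₂ hmax

theorem neg_log_le_posLog_tilde_add {t₁ t₂ : ℝ} (ht₁ : 0 < t₁) (ht₂ : 0 < t₂)
    (hmin : min t₁ t₂ ≤ ν) (hν : ν ≤ δ / 2) :
    -Real.log ν ≤ log⁺ (tilde δ t₁) + log⁺ (tilde δ t₂) := by
  rcases min_le_iff.1 hmin with h | h
  · exact (neg_log_le_posLog_tilde ht₁ h hν).trans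
      (le_add_of_nonneg_right Real.posLog_nonneg)
  · exact (neg_log_le_posLog_tilde ht₂ h hν).trans
      (le_add_of_nonneg_left Real.posLog_nonneg)

end ConeParameters

end Toda

end

theorem lemma4p3_general {M : Type*} [MetricSpace M] [CompactSpace M] [ChartedSpace Toda.Plane M]
    [IsManifold (𝓡 2) 1 M]
    [RiemannianBundle (fun x : M ↦ TangentSpace (𝓡 2) x)]
    [IsContinuousRiemannianBundle Toda.Plane (fun x : M ↦ TangentSpace (𝓡 2) x)]
    [IsRiemannianManifold (𝓡 2) M] [MeasurableSpace M] [BorelSpace M]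
    (hvol : Toda.riemVolume M Set.univ = 1)
    (h₁ h₂ : M → ℝ) (hh₁ : Continuous h₁) (hh₂ : Continuous h₂)
    (hpos₁ : ∀ x, 0 < h₁ x) (hpos₂ : ∀ x, 0 < h₂ x)
    (ρ₁ ρ₂ : ℝ) (hρ₁ : 4 * Real.pi < ρ₁) (hρ₂ : 4 * Real.pi < ρ₂)
    (δ : ℝ) (hδ : 0 < δ) :
    (∀ ν : ℝ, 0 < ν → ∀ p ∈ Toda.Xν M δ ν,
      Toda.MemH1 (Toda.φ₁ p) ∧ Toda.MemH1 (Toda.φ₂ p)) ∧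
    ∀ L : ℝ, ∃ ν₀ > 0, ∀ ν : ℝ, 0 < ν → ν < ν₀ → ∀ p ∈ Toda.Xν M δ ν,
      Toda.J ρ₁ ρ₂ h₁ h₂ (Toda.φ₁ p) (Toda.φ₂ p) ≤ -L := by
  have : IsProbabilityMeasure (Toda.riemVolume M) := ⟨hvol⟩
  refine ⟨fun ν _ p hp ↦ ?_, fun L ↦ ?_⟩
  · obtain ⟨x₁, x₂, t₁, t₂, -, -, -, -, hφ₁, hφ₂⟩ := Toda.exists_bubble_of_mem_Xν hδ hp
    exact ⟨hφ₁ ▸ Toda.memH1_bubble _ x₁ _ x₂, hφ₂ ▸ Toda.memH1_bubble _ x₂ _ x₁⟩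
  obtain ⟨a, ha, C, hJ⟩ := Toda.exists_J_bubble_le hh₁ hh₂ hpos₁ hpos₂ hρ₁ hρ₂
    (2 / δ ^ 2 + 2 / δ) (c := δ ^ 2 / 2) (by positivity)
  refine ⟨min (δ / 2) (Real.exp (-((C + L) / a))), by positivity, fun ν hν hνν₀ p hp ↦ ?_⟩
  obtain ⟨x₁, x₂, t₁, t₂, ht₁, ht₂, hmin, hsep, hφ₁, hφ₂⟩ := Toda.exists_bubble_of_mem_Xν hδ hp
  have hlog : (C + L) / a < -Real.log ν :=
    lt_neg_of_lt_neg ((Real.log_lt_iff_lt_exp hν).2 (hνν₀.trans_le (min_le_right _ _)))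
  have hsum := hlog.le.trans
    (Toda.neg_log_le_posLog_tilde_add ht₁ ht₂ hmin (hνν₀.le.trans (min_le_left _ _)))
  rw [div_le_iff₀' ha] at hsum
  rw [hφ₁, hφ₂]
  linarith [hJ _ _ x₁ x₂ hsep]

theorem lemma4p3 {M : Type*} [MetricSpace M] [CompactSpace M] [ChartedSpace Toda.Plane M]
    [IsManifold (𝓡 2) ∞ M]
    [RiemannianBundle (fun x : M ↦ TangentSpace (𝓡 2) x)]
    [IsContMDiffRiemannianBundle (𝓡 2) ∞ Toda.Plane (fun x : M ↦ TangentSpace (𝓡 2) x)]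
    [IsRiemannianManifold (𝓡 2) M] [MeasurableSpace M] [BorelSpace M]
    (hvol : Toda.riemVolume M Set.univ = 1)
    (h₁ h₂ : M → ℝ) (hh₁ : ContMDiff (𝓡 2) 𝓘(ℝ, ℝ) 1 h₁) (hh₂ : ContMDiff (𝓡 2) 𝓘(ℝ, ℝ) 1 h₂)
    (hpos₁ : ∀ x, 0 < h₁ x) (hpos₂ : ∀ x, 0 < h₂ x)
    (ρ₁ ρ₂ : ℝ) (hρ₁ : 4 * Real.pi < ρ₁) (hρ₂ : 4 * Real.pi < ρ₂)
    (δ : ℝ) (hδ : 0 < δ) :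
    (∀ ν : ℝ, 0 < ν → ∀ p ∈ Toda.Xν M δ ν,
      Toda.MemH1 (Toda.φ₁ p) ∧ Toda.MemH1 (Toda.φ₂ p)) ∧
    ∀ L : ℝ, ∃ ν₀ > 0, ∀ ν : ℝ, 0 < ν → ν < ν₀ → ∀ p ∈ Toda.Xν M δ ν,
      Toda.J ρ₁ ρ₂ h₁ h₂ (Toda.φ₁ p) (Toda.φ₂ p) ≤ -L := by
  have := Toda.isContinuousRiemannianBundle_of_contMDiff (𝓡 2) ∞ Toda.Plane
    (fun x : M ↦ TangentSpace (𝓡 2) x)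
  exact lemma4p3_general hvol h₁ h₂ hh₁.continuous hh₂.continuous hpos₁ hpos₂ ρ₁ ρ₂ hρ₁ hρ₂ δ hδ
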